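/- Conventions. Fix $d\ge 1$ and a finite alphabet $\mathcal A$. A $d$-dimensional subshift is a closed (for the product of the discrete topologies) subset $\Sigma\subset\mathcal A^{\mathbb Z^d}$ invariant under all shifts. For finite $U\subset\mathbb Z^d$, $\mathcal L_U(\Sigma)\subset\mathcal A^U$ is the set of patterns $x|_U$, $x\in\Sigma$; $\mathcal L(\Sigma)=\bigcup_U\mathcal L_U(\Sigma)$ is the language and $\mathcal L_n(\Sigma)=\mathcal L_{[0,n-1]^d}(\Sigma)$. The subshift is decidable if some algorithm, given a finite pattern (as a list of pairs position/symbol), halts and tells whether it belongs to $\mathcal L(\Sigma)$. Its entropy is $h(\Sigma)=\lim_{n\to\infty}\log_2(\#\mathcal L_n(\Sigma))/n^d$. For $f:\mathbb N\to\mathbb N$, $\Sigma$ is $f$-irreducible if for every $n$, all finite $U,V\subset\mathbb Z^d$ of diameter at most $n$ with $\min_{i\in U,\,j\in V}d(i,j)>f(n)$ (Chebyshev distance), and all $u\in\mathcal L_U(\Sigma)$, $v\in\mathcal L_V(\Sigma)$, there is $x\in\Sigma$ with $x|_U=u$ and $x|_V=v$. A real $\alpha$ is $\Pi_1$-computable if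 $\alpha=\inf_n\varphi(n)$ for some computable $\varphi:\mathbb N\to\mathbb Q$. Theorem. Let $f:\mathbb N\to\mathbb N$ be a computable non-decreasing function such that $f(n+1)-f(n)\in\{0,1\}$ for all $n$ and $\sum_{n\ge1} f(n)/n^2=+\infty$, and let $d\ge1$. (1) For every $\Pi_1$-computable real $\alpha>0$ there exist a finite alphabet and a decidable $f$-irreducible $d$-dimensional subshift over it with entropy exactly $\alpha$. (2) Consequently, no algorithm computes the entropy of decidable $f$-irreducible $d$-dimensional subshifts, even over a suitable fixed alphabet: there is a finite alphabet for which there is no algorithm that, given any program deciding the language of a nonempty $f$-irreducible $d$-dimensional subshift $\Sigma$ over this alphabet and given $n\in\mathbb N$, halts and returns a rational number $r$ with $|h(\Sigma)-r|\le 2^{-n}$. -/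

import Mathlib

namespace EntropyIrr

open Filter Topology SymbolicDynamics.FullShift

/-- A subshift on the alphabet `{0, …, k-1}` (discrete topology) in dimension `d`: a closed subset
of `(Fin k)^(ℤ^d)` that is invariant under all shifts. -/
abbrev ZSubshift (d k : ℕ) : Type := Subshift (Fin k) (Fin d → ℤ)

/-- `L_U(X)`: the patterns `u ∈ A^U` on the finite set `U` that appear in some point of `X`. -/
def languageOn {d k : ℕ} (X : ZSubshift d k) (U : Finset (Fin d → ℤ)) : Set (U → Fin k) :=
  {u | ∃ x ∈ X.carrier, ∀ i : U, x i = u i}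

/-- The cube `[0, n-1]^d`. -/
noncomputable def box (d n : ℕ) : Finset (Fin d → ℤ) :=
  Fintype.piFinset fun _ => Finset.Ico (0 : ℤ) n

/-- `X` has topological entropy `h`: `log₂ #L_n(X) / n^d → h`. -/
def HasEntropy {d k : ℕ} (X : ZSubshift d k) (h : ℝ) : Prop :=
  Tendsto (fun n : ℕ => Real.logb 2 ((languageOn X (box d n)).ncard : ℝ) / (n : ℝ) ^ d)
    atTop (𝓝 h)

/-- `f`-irreducibility. The distance on `Fin d → ℤ` is the Chebyshev distance. -/
def IsIrreducible {d k : ℕ} (f : ℕ → ℕ) (X : ZSubshift d k) : Prop :=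
  ∀ (n : ℕ) (U V : Finset (Fin d → ℤ)),
    (∀ i ∈ U, ∀ j ∈ U, dist i j ≤ n) → (∀ i ∈ V, ∀ j ∈ V, dist i j ≤ n) →
    (∀ i ∈ U, ∀ j ∈ V, (f n : ℝ) < dist i j) →
    ∀ u ∈ languageOn X U, ∀ v ∈ languageOn X V,
      ∃ x ∈ X.carrier, (∀ i : U, x i = u i) ∧ (∀ j : V, x j = v j)

/-- Finite patterns are given to algorithms as finite lists of pairs (position, symbol). The list
`w` encodes the pattern `u` on `U` when its entries are exactly the pairs `(i, u i)`, `i ∈ U`. -/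
def Encodes {d k : ℕ} (w : List ((Fin d → ℤ) × Fin k)) {U : Finset (Fin d → ℤ)}
    (u : U → Fin k) : Prop :=
  ∀ i a, (i, a) ∈ w ↔ ∃ h : i ∈ U, u ⟨i, h⟩ = a

/-- The encoded language of `X`: the lists that encode a pattern of `L(X) = ⋃_U L_U(X)`. -/
def language {d k : ℕ} (X : ZSubshift d k) : Set (List ((Fin d → ℤ) × Fin k)) :=
  {w | ∃ U : Finset (Fin d → ℤ), ∃ u ∈ languageOn X U, Encodes w u}

theorem mem_language_iff {d k : ℕ} (X : ZSubshift d k) (w : List ((Fin d → ℤ) × Fin k)) :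
    w ∈ language X ↔ ∃ x ∈ X.carrier, ∀ p ∈ w, x p.1 = p.2 := by
  constructor
  · rintro ⟨U, u, ⟨x, hx, hxu⟩, hw⟩
    refine ⟨x, hx, fun p hp => ?_⟩
    obtain ⟨h, e⟩ := (hw p.1 p.2).1 hp
    rw [← e, ← hxu]
  · rintro ⟨x, hx, hw⟩
    classical
    refine ⟨(w.map Prod.fst).toFinset, fun i => x i, ⟨x, hx, fun _ => rfl⟩, fun i a => ?_⟩
    constructor
    · intro h
      exact ⟨by simpa using ⟨a, h⟩, hw _ h⟩
    · rintro ⟨h, e⟩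
      obtain ⟨b, hb⟩ : ∃ b, (i, b) ∈ w := by simpa using h
      have := hw _ hb
      simp only at this e
      rw [← e, this]
      exact hb

/-- `X` is decidable: its language is decidable. -/
def IsDecidable {d k : ℕ} (X : ZSubshift d k) : Prop :=
  ComputablePred fun w : List ((Fin d → ℤ) × Fin k) => w ∈ language X

/-- The Gödel number of an encoded pattern, in the encoding that underlies computability of
predicates on such lists. -/
def patternCode {d k : ℕ} (w : List ((Fin d → ℤ) × Fin k)) : ℕ :=
  @Encodable.encode _ Primcodable.toEncodable w

/-- The program `c` decides the language of `X`: on every encoded input it halts and returns `1`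
if the input is in the language and `0` otherwise. -/
def Decides {d k : ℕ} (c : Nat.Partrec.Code) (X : ZSubshift d k) : Prop :=
  ∀ w : List ((Fin d → ℤ) × Fin k),
    (w ∈ language X → 1 ∈ c.eval (patternCode w)) ∧
    (w ∉ language X → 0 ∈ c.eval (patternCode w))

/-- A computable sequence of rationals, each given by a numerator and a denominator. -/
def IsComputableRatSeq (φ : ℕ → ℚ) : Prop :=
  ∃ (p : ℕ → ℤ) (q : ℕ → ℕ), Computable p ∧ Computable q ∧
    ∀ n, q n ≠ 0 ∧ φ n = (p n : ℚ) / (q n : ℚ)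

/-- `α` is `Π₁`-computable: the infimum of a computable sequence of rationals. -/
def IsPi1Computable (α : ℝ) : Prop :=
  ∃ φ : ℕ → ℚ, IsComputableRatSeq φ ∧ IsGLB (Set.range fun n => (φ n : ℝ)) α

/-- The (partial) algorithm `alg` computes the entropy of all nonempty `f`-irreducible decidable
subshifts in dimension `d` over the alphabet `{0, …, k-1}`: given any program `c` that decides the
language of such a subshift `X` and given `n`, it halts and returns a fraction (numerator,
denominator) that approximates the entropy of `X` within `2^{-n}`. -/
def ComputesEntropy (f : ℕ → ℕ) (d k : ℕ) (alg : Nat.Partrec.Code × ℕ →. ℤ × ℕ) : Prop :=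
  ∀ X : ZSubshift d k, X.carrier.Nonempty → IsIrreducible f X →
    ∀ c : Nat.Partrec.Code, Decides c X → ∀ h : ℝ, HasEntropy X h →
      ∀ n : ℕ, ∃ r ∈ alg (c, n), r.2 ≠ 0 ∧ |h - (r.1 : ℝ) / (r.2 : ℝ)| ≤ (2 : ℝ)⁻¹ ^ n

end EntropyIrr

namespace EntropyIrr

open Filter Topology SymbolicDynamics.FullShift

/-! The subshift consists of the configurations whose nonzero symbols, on every row in the first
direction, number at most `p m` in each window of length `m`. Rows are independent, so the entropy
is the growth rate of one-dimensional admissible blocks. Erasing symbols preserves admissibility, so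
a consistent pattern lies in the language as soon as its own windows obey `p`.

The profile `p` grows only as far as needed to glue blocks of lengths `b ≤ a` across a gap `G a`.
Gluing gives `f`-irreducibility provided `G (n + 1) ≤ f n` (`Adm.union`,
`isIrreducible_densityShift`). Minimal growth makes gaps cost density: if `gapSum G`, which is
comparable to the partial sums of `G n / n ^ 2`, diverges, then `p m / m → 0`
(`IsProfile.tendsto_div_zero`) and a Chernoff bound makes the entropy vanish (`lim_eq_zero`).

The gaps are chosen adaptively. Let `a` be a computable sequence with infimum `α`. The gap increases
by one, if `f` permits, exactly when the blocks of the current length are so numerous that the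
larger gap still leaves an entropy above some early `a i`. Each increase therefore respects the
bound `α` from below (`IsProfile.le_lim`). If the entropy exceeded `α`, the test would eventually
always succeed; then either `G` grows linearly or it catches up with `f`, and the divergence of `∑ f
n / n ^ 2` would force the entropy to be `0` (`IsProfile.lim_le`).

The test compares integers, so `p` and `G` are computable uniformly in `a`, and so is the language.
A sequence that drops from `1` to `1 / 2` when a program halts then encodes the halting problem in
the entropy. -/

/-! ### Density profiles: how gaps reduce the density. -/

/-- A density profile `p` with gaps `G`: two blocks of lengths `b ≤ a` that are `G a` apart may be
filled up to their bounds, and `p` grows only as this rule forces it to. -/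
structure IsProfile (p G : ℕ → ℕ) : Prop where
  zero : p 0 = 0
  one : p 1 = 1
  mono : Monotone p
  glue : ∀ a b, b ≤ a → p a + p b ≤ p (a + b + G a)
  succ_le : ∀ n, 1 ≤ n → p (n + 1) ≤ p n ∨
    ∃ a b, b ≤ a ∧ a ≤ n ∧ a + b + G a ≤ n + 1 ∧ p (n + 1) = p a + p b
  gap_zero : G 0 = 0
  gap_succ : ∀ n, G (n + 1) = G n ∨ G (n + 1) = G n + 1

/-- The weighted sum of the increments of the gap function. -/
noncomputable def gapSum (G : ℕ → ℕ) (n : ℕ) : ℝ :=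
  ∑ k ∈ Finset.Ico 1 n, ((G (k + 1) : ℝ) - G k) / k

/-- Summation by parts. -/
theorem gapSum_eq (G : ℕ → ℕ) {n : ℕ} (hn : 1 ≤ n) :
    gapSum G n = (G n : ℝ) / n - G 1 +
      ∑ k ∈ Finset.Ico 1 n, (G (k + 1) : ℝ) / (k * (k + 1)) := by
  induction n, hn using Nat.le_induction with
  | base => simp [gapSum]
  | succ n hn ih =>
    have hn0 : (0 : ℝ) < n := by exact_mod_cast hn
    rw [gapSum, Finset.sum_Ico_succ_top hn, ← gapSum, ih, Finset.sum_Ico_succ_top hn]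
    push_cast
    field_simp
    ring

namespace IsProfile

variable {p G : ℕ → ℕ}

theorem gap_mono (h : IsProfile p G) : Monotone G :=
  monotone_nat_of_le_succ fun n => by rcases h.gap_succ n with e | e <;> omega

theorem gap_le_self (h : IsProfile p G) (n : ℕ) : G n ≤ n := by
  induction n with
  | zero => simp [h.gap_zero]
  | succ n ih => rcases h.gap_succ n with e | e <;> omega

theorem le_self (h : IsProfile p G) (n : ℕ) : p n ≤ n := by
  induction n using Nat.strong_induction_on with
  | _ n ih =>
    rcases n with _ | n
    · simp [h.zero]
    rcases Nat.eq_zero_or_pos n with rfl | hn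
    · simp [h.one]
    rcases h.succ_le n hn with e | ⟨a, b, hba, han, hab, e⟩
    · have := ih n (by omega); omega
    · have := ih a (by omega); have := ih b (by omega); omega

/-- The bound is superadditive under gluing: if `a > n`, the gap `G a ≥ G (n + 1)` pays for the
second copy of `G (n + 1)` in the bounds for `p a` and `p b`. If `a ≤ n`, the value is already
reached at `a + b + G a ≤ 2 * n + G n`. Hence only that initial range has to be checked when `δ` is
lowered to `δ'`. -/
theorem le_step (h : IsProfile p G) {n : ℕ} (hn : 1 ≤ n) {δ δ' : ℝ} (hδ' : 0 ≤ δ')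
    (hclaim : ∀ m, (p m : ℝ) ≤ δ * (m + G n))
    (hkey : ∀ m, m ≤ 2 * n + G n → δ * (m + G n) ≤ δ' * (m + G (n + 1))) (m : ℕ) :
    (p m : ℝ) ≤ δ' * (m + G (n + 1)) := by
  induction m using Nat.strong_induction_on with
  | _ m ih =>
    by_cases hm : m ≤ 2 * n + G n
    · exact (hclaim m).trans (hkey m hm)
    obtain ⟨m, rfl⟩ : ∃ m', m = m' + 1 := ⟨m - 1, by omega⟩
    rcases h.succ_le m (by omega) with e | ⟨a, b, hba, han, hab, e⟩
    · calc (p (m + 1) : ℝ) ≤ p m := by exact_mod_cast e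
        _ ≤ _ := ih m (by omega)
        _ ≤ _ := by gcongr; omega
    · by_cases ha : n + 1 ≤ a
      · have hG := h.gap_mono ha
        have h1 := ih a (by omega)
        have h2 := ih b (by omega)
        have h3 : (a : ℝ) + b + G (n + 1) ≤ (m + 1 : ℕ) := by exact_mod_cast (by omega)
        rw [e]
        push_cast at h3 ⊢
        nlinarith
      · have hG := h.gap_mono (show a ≤ n by omega)
        calc (p (m + 1) : ℝ) ≤ p (a + b + G a) := by
              rw [e]; exact_mod_cast h.glue a b hba
          _ ≤ _ := ih _ (by omega)
          _ ≤ _ := by gcongr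

/-- Each increase of the gap at `n` lowers the density bound by a factor `exp (-1 / (5 * n))`. -/
theorem le_exp_gapSum (h : IsProfile p G) {n : ℕ} (hn : 1 ≤ n) (m : ℕ) :
    (p m : ℝ) ≤ Real.exp (-gapSum G n / 5) * (m + G n) := by
  induction n, hn using Nat.le_induction generalizing m with
  | base =>
    have := h.le_self m
    simp only [gapSum, Finset.Ico_self, Finset.sum_empty, neg_zero, zero_div, Real.exp_zero,
      one_mul]
    exact_mod_cast (by omega)
  | succ n hn ih =>
    refine h.le_step hn (Real.exp_nonneg _) ih (fun m hm => ?_) m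
    have hn0 : (0 : ℝ) < n := by exact_mod_cast hn
    have e : -gapSum G (n + 1) / 5 = -gapSum G n / 5 + -(((G (n + 1) : ℝ) - G n) / (5 * n)) := by
      rw [gapSum, Finset.sum_Ico_succ_top hn, ← gapSum]
      field_simp
      ring
    rw [e, Real.exp_add, mul_assoc]
    refine mul_le_mul_of_nonneg_left ?_ (Real.exp_nonneg _)
    rcases h.gap_succ n with e | e
    · simp [e]
    · rw [e]
      push_cast
      have h1 := Real.add_one_le_exp (-((G n : ℝ) + 1 - G n) / (5 * n))
      rw [neg_div] at h1
      have h2 := h.gap_le_self n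
      -- This is the origin of the constant `5`: `m ≤ 2 * n + G n`, `G n ≤ n` and `1 ≤ n`.
      have h3 : (m : ℝ) + G n + 1 ≤ 5 * n := by exact_mod_cast (by omega)
      refine le_trans ?_ (mul_le_mul_of_nonneg_right h1 (by positivity))
      have : ((m : ℝ) + G n + 1) / (5 * n) ≤ 1 := by rw [div_le_one (by positivity)]; exact h3
      have e2 : (-(((G n : ℝ) + 1 - G n) / (5 * n)) + 1) * (m + (G n + 1))
          = (m + G n + 1) - (m + G n + 1) / (5 * n) := by ring
      rw [e2]; linarith

theorem gapSum_mono (h : IsProfile p G) : Monotone (gapSum G) := by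
  intro a b hab
  refine Finset.sum_le_sum_of_subset_of_nonneg (Finset.Ico_subset_Ico_right hab) fun k _ _ => ?_
  have : (G k : ℝ) ≤ G (k + 1) := by exact_mod_cast h.gap_mono (Nat.le_succ k)
  exact div_nonneg (by linarith) (by positivity)

/-- If the gap sums diverge then the density of the profile vanishes. -/
theorem tendsto_div_zero (h : IsProfile p G) (hS : Tendsto (gapSum G) atTop atTop) :
    Tendsto (fun m : ℕ => (p m : ℝ) / m) atTop (𝓝 0) := by
  have hlim : Tendsto (fun n => Real.exp (-gapSum G n / 5)) atTop (𝓝 0) := by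
    refine Real.tendsto_exp_atBot.comp ?_
    have := (tendsto_neg_atTop_atBot.comp hS).atBot_div_const (show (0 : ℝ) < 5 by norm_num)
    exact this
  refine tendsto_order.2 ⟨fun a ha => Eventually.of_forall fun m => ha.trans_le (by positivity),
    fun ε hε => ?_⟩
  -- With the exponential below `ε / 4`, every `m ≥ G n` has `p m ≤ ε / 4 * (m + G n) ≤ ε / 2 * m`.
  obtain ⟨n, hn1, hn⟩ := ((eventually_ge_atTop 1).and
    (hlim.eventually_lt_const (half_pos (half_pos hε)))).exists
  filter_upwards [eventually_ge_atTop (max 1 (G n))] with m hm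
  have hm1 : (0 : ℝ) < m := by exact_mod_cast lt_of_lt_of_le one_pos ((le_max_left _ _).trans hm)
  have hm2 : (G n : ℝ) ≤ m := by exact_mod_cast (le_max_right _ _).trans hm
  rw [div_lt_iff₀ hm1]
  have h1 := h.le_exp_gapSum hn1 m
  have h2 := Real.exp_pos (-gapSum G n / 5)
  nlinarith

/-- If the gap sums are bounded then the gaps grow sublinearly. -/
theorem gap_div_tendsto_zero (h : IsProfile p G) {B : ℝ} (hB : ∀ n, gapSum G n ≤ B) :
    Tendsto (fun n : ℕ => (G n : ℝ) / n) atTop (𝓝 0) := by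
  have hlim := tendsto_atTop_ciSup h.gapSum_mono ⟨B, by rintro _ ⟨n, rfl⟩; exact hB n⟩
  set s := ⨆ n, gapSum G n
  have hle : ∀ n, gapSum G n ≤ s := fun n => h.gapSum_mono.ge_of_tendsto hlim n
  refine tendsto_order.2 ⟨fun a ha => Eventually.of_forall fun m => ha.trans_le (by positivity),
    fun ε hε => ?_⟩
  obtain ⟨k, hk1, hk⟩ := ((eventually_ge_atTop 1).and
    (hlim.eventually_const_lt (show s - ε / 2 < s by linarith))).exists
  -- An increase of the gap at `j ≤ m` contributes `1 / j ≥ 1 / m` to the gap sum, so the tail of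
  -- the sum controls the growth of `G` beyond `k`.
  have key : ∀ n, k ≤ n → ∀ m : ℝ, n ≤ m → (G n : ℝ) ≤ G k + m * (gapSum G n - gapSum G k) := by
    intro n hn
    induction n, hn using Nat.le_induction with
    | base => intro m _; simp
    | succ n hn ih =>
      intro m hm
      have hn0 : (0 : ℝ) < n := by exact_mod_cast (by omega : 0 < n)
      push_cast at hm
      have := ih m (by linarith)
      have e : gapSum G (n + 1) = gapSum G n + ((G (n + 1) : ℝ) - G n) / n := by
        rw [gapSum, Finset.sum_Ico_succ_top (by omega), ← gapSum]
      have hG : (0 : ℝ) ≤ (G (n + 1) : ℝ) - G n := by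
        have : (G n : ℝ) ≤ G (n + 1) := by exact_mod_cast h.gap_mono (Nat.le_succ n)
        linarith
      have : (G (n + 1) : ℝ) - G n ≤ m * (((G (n + 1) : ℝ) - G n) / n) := by
        rw [← mul_div_assoc, le_div_iff₀ hn0, mul_comm]
        exact mul_le_mul_of_nonneg_right (by linarith) hG
      rw [e]
      linarith
  obtain ⟨M, hM⟩ := exists_nat_gt (2 * (G k : ℝ) / ε)
  filter_upwards [eventually_ge_atTop (max k (M + 1))] with n hn
  have hn1 : M + 1 ≤ n := (le_max_right _ _).trans hn
  have hn0 : (0 : ℝ) < n := by exact_mod_cast (by omega : 0 < n)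
  rw [div_lt_iff₀ hn0]
  have h1 := key n ((le_max_left _ _).trans hn) n le_rfl
  have h2 : (M : ℝ) < n := by exact_mod_cast hn1
  rw [div_lt_iff₀ hε] at hM
  have h3 := hle n
  nlinarith

end IsProfile

/-! ### Admissible sets of integers and their gluing. -/

/-- A set of integers is admissible for `p` if each window of length `m` holds at most `p m` of its
points. -/
def Adm (p : ℕ → ℕ) (S : Set ℤ) : Prop :=
  ∀ (F : Finset ℤ) (m : ℕ), (F : Set ℤ) ⊆ S → (∀ s ∈ F, ∀ t ∈ F, s - t < m) → F.card ≤ p m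

theorem Adm.subset {p : ℕ → ℕ} {S T : Set ℤ} (hT : Adm p T) (h : S ⊆ T) : Adm p S :=
  fun F m hF => hT F m (hF.trans h)

theorem adm_empty (p : ℕ → ℕ) : Adm p ∅ := fun F m hF _ => by
  have : F = ∅ := by simpa using hF
  simp [this]

theorem Adm.shift {p : ℕ → ℕ} {S : Set ℤ} (hS : Adm p S) (v : ℤ) : Adm p {t | t + v ∈ S} := by
  intro F m hF hm
  rw [← Finset.card_image_of_injective F (add_left_injective v)]
  refine hS _ m ?_ ?_
  · intro t ht
    obtain ⟨s, hs, rfl⟩ : ∃ s ∈ F, s + v = t := Finset.mem_image.1 ht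
    exact hF hs
  · simp only [Finset.mem_image]
    rintro _ ⟨s, hs, rfl⟩ _ ⟨t, ht, rfl⟩
    have := hm s hs t ht
    simpa using this

/-- Two finite admissible sets whose mutual distance exceeds the gap required at their diameter,
possibly interleaved, fit together. -/
theorem card_add_card_le {p : ℕ → ℕ} (hmono : Monotone p) {n c : ℕ}
    (hglue : ∀ a b, a ≤ n + 1 → b ≤ n + 1 → p a + p b ≤ p (a + b + c)) {S T : Finset ℤ}
    (hS : Adm p S) (hT : Adm p T) (dS : ∀ s ∈ S, ∀ t ∈ S, s - t ≤ n)
    (dT : ∀ s ∈ T, ∀ t ∈ T, s - t ≤ n) (hgap : ∀ s ∈ S, ∀ t ∈ T, (c : ℤ) < |s - t|)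
    (neS : S.Nonempty) (neT : T.Nonempty) {m : ℕ}
    (hm : ∀ s ∈ S ∪ T, ∀ t ∈ S ∪ T, s - t < m) : S.card + T.card ≤ p m := by
  induction hN : S.card + T.card using Nat.strong_induction_on generalizing S T m with
  | _ N ih =>
  subst hN
  -- The maxima differ because the sets are at positive distance. The part of `T` above `max S` is
  -- split off; the rest of `T` together with `S` is handled by induction on the total number of
  -- points.
  wlog hlt : S.max' neS < T.max' neT generalizing S T
  · rw [add_comm]
    refine this hT hS dT dS (fun s hs t ht => ?_) neT neS ?_ ?_ ?_
    · rw [abs_sub_comm]; exact hgap t ht s hs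
    · rwa [Finset.union_comm]
    · intro k hk; rw [add_comm] at hk; exact ih k hk
    · rcases lt_or_eq_of_le (not_lt.1 hlt) with h | h
      · exact h
      · have := hgap _ (S.max'_mem neS) _ (T.max'_mem neT)
        rw [h] at this
        simp at this
        omega
  set s := S.max' neS with hs
  have hsS : s ∈ S := S.max'_mem neS
  set M := T.max' neT with hM
  have hMT : M ∈ T := T.max'_mem neT
  set T0 := T.filter (· < s) with hT0
  set T1 := T.filter (s < ·) with hT1
  have hTc : T.card = T0.card + T1.card := by
    rw [← Finset.card_union_of_disjoint]
    · congr 1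
      ext t
      simp only [hT0, hT1, Finset.mem_union, Finset.mem_filter]
      refine ⟨fun ht => ?_, by tauto⟩
      have h1 := hgap s hsS t ht
      rcases lt_trichotomy t s with h | h | h
      · exact Or.inl ⟨ht, h⟩
      · rw [h] at h1; simp at h1; omega
      · exact Or.inr ⟨ht, h⟩
    · rw [Finset.disjoint_filter]
      intro t _ h1 h2; omega
  have neT1 : T1.Nonempty := ⟨M, by simp [hT1, hMT, hlt]⟩
  have sub0 : T0 ⊆ T := Finset.filter_subset _ _
  have sub1 : T1 ⊆ T := Finset.filter_subset _ _
  have hleS : ∀ t ∈ S, t ≤ s := fun t ht => S.le_max' t ht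
  have hleT : ∀ t ∈ T, t ≤ M := fun t ht => T.le_max' t ht
  have neL : (S ∪ T0).Nonempty := neS.mono Finset.subset_union_left
  set l := (S ∪ T0).min' neL with hl
  have hlmem : l ∈ S ∪ T0 := Finset.min'_mem _ _
  have hlle : ∀ t ∈ S ∪ T0, l ≤ t := fun t ht => Finset.min'_le _ t ht
  have hls : l ≤ s := hlle s (Finset.mem_union_left _ hsS)
  -- The left part still has diameter at most `n`: if its minimum `l` lies in `T`, then `s - l < M -
  -- l ≤ n`. So `hglue` applies although the left part mixes both sets.
  have hsl : s - l ≤ n := by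
    rcases Finset.mem_union.1 hlmem with h | h
    · exact dS s hsS l h
    · have := dT M hMT l (sub0 h); omega
  have hup : ∀ t ∈ S ∪ T0, t ≤ s := by
    intro t ht
    rcases Finset.mem_union.1 ht with h | h
    · exact hleS t h
    · exact (Finset.mem_filter.1 h).2.le
  have hspan : ∀ t ∈ S ∪ T0, ∀ t' ∈ S ∪ T0, t - t' < ((s - l + 1).toNat : ℤ) := by
    intro t ht t' ht'
    have := hup t ht
    have := hlle t' ht'
    omega
  have left : S.card + T0.card ≤ p (s - l + 1).toNat := by
    rcases T0.eq_empty_or_nonempty with h0 | ne0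
    · rw [h0, Finset.card_empty, add_zero]
      exact hS S _ subset_rfl fun t ht t' ht' => hspan t (Finset.mem_union_left _ ht) t'
        (Finset.mem_union_left _ ht')
    · have : 0 < T1.card := neT1.card_pos
      exact ih _ (by omega) hS (hT.subset (by exact_mod_cast sub0)) dS
        (fun t ht t' ht' => dT t (sub0 ht) t' (sub0 ht'))
        (fun t ht t' ht' => hgap t ht t' (sub0 ht')) neS ne0 hspan rfl
  set r := T1.min' neT1 with hr
  have hrmem : r ∈ T1 := Finset.min'_mem _ _
  have right : T1.card ≤ p (M - r + 1).toNat := by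
    refine hT T1 _ (by exact_mod_cast sub1) fun t ht t' ht' => ?_
    have := hleT t (sub1 ht)
    have : r ≤ t' := Finset.min'_le _ t' ht'
    omega
  have hMr : M - r ≤ n := dT M hMT r (sub1 hrmem)
  have hrs := (Finset.mem_filter.1 hrmem).2
  have hrM := hleT r (sub1 hrmem)
  have hcs : (c : ℤ) < r - s := by
    have := hgap s hsS r (sub1 hrmem)
    rwa [abs_sub_comm, abs_of_pos (by omega)] at this
  have hMl : M - l < m := hm M (Finset.mem_union_right _ hMT) l
    (Finset.union_subset_union_right sub0 hlmem)
  calc S.card + T.card ≤ p (s - l + 1).toNat + p (M - r + 1).toNat := by omega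
    _ ≤ p ((s - l + 1).toNat + (M - r + 1).toNat + c) := hglue _ _ (by omega) (by omega)
    _ ≤ p m := hmono (by omega)

theorem Adm.union {p : ℕ → ℕ} (hmono : Monotone p) {n c : ℕ}
    (hglue : ∀ a b, a ≤ n + 1 → b ≤ n + 1 → p a + p b ≤ p (a + b + c)) {S T : Set ℤ}
    (hS : Adm p S) (hT : Adm p T) (dS : ∀ s ∈ S, ∀ t ∈ S, s - t ≤ n)
    (dT : ∀ s ∈ T, ∀ t ∈ T, s - t ≤ n) (hgap : ∀ s ∈ S, ∀ t ∈ T, (c : ℤ) < |s - t|) :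
    Adm p (S ∪ T) := by
  classical
  intro F m hF hm
  have e : F = F.filter (· ∈ S) ∪ F.filter (· ∈ T) := by
    ext t
    simp only [Finset.mem_union, Finset.mem_filter]
    refine ⟨fun ht => ?_, by tauto⟩
    rcases hF ht with h | h <;> tauto
  have subS : ((F.filter (· ∈ S) : Finset ℤ) : Set ℤ) ⊆ S := fun t ht => by simp at ht; exact ht.2
  have subT : ((F.filter (· ∈ T) : Finset ℤ) : Set ℤ) ⊆ T := fun t ht => by simp at ht; exact ht.2
  rcases (F.filter (· ∈ S)).eq_empty_or_nonempty with h0 | neS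
  · refine hT F m ?_ hm
    rw [e, h0, Finset.empty_union]; exact subT
  rcases (F.filter (· ∈ T)).eq_empty_or_nonempty with h0 | neT
  · refine hS F m ?_ hm
    rw [e, h0, Finset.union_empty]; exact subS
  rw [e]
  refine (Finset.card_union_le _ _).trans ?_
  refine card_add_card_le hmono hglue (hS.subset subS) (hT.subset subT)
    (fun s hs t ht => dS s (subS hs) t (subS ht)) (fun s hs t ht => dT s (subT hs) t (subT ht))
    (fun s hs t ht => hgap s (subS hs) t (subT ht)) neS neT ?_
  rw [← e]; exact hm

theorem IsProfile.glue_of_le {p G : ℕ → ℕ} (h : IsProfile p G) {n c : ℕ} (hc : G n ≤ c) (a b : ℕ)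
    (ha : a ≤ n) (hb : b ≤ n) : p a + p b ≤ p (a + b + c) := by
  rcases le_total b a with hab | hab
  · exact (h.glue a b hab).trans (h.mono (by have := h.gap_mono ha; omega))
  · rw [add_comm]
    exact (h.glue b a hab).trans (h.mono (by have := h.gap_mono hb; omega))

/-! ### Counting admissible blocks. -/

/-- The admissible sequences that vanish outside of `[0, n)`. -/
def blocks (p : ℕ → ℕ) (K n : ℕ) : Set (ℤ → Fin (K + 1)) :=
  {x | Adm p {t | x t ≠ 0} ∧ ∀ t, x t ≠ 0 → 0 ≤ t ∧ t < n}

section blocks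

variable {p : ℕ → ℕ} {K : ℕ}

theorem blocks_eq_zero {n : ℕ} {x : ℤ → Fin (K + 1)} (hx : x ∈ blocks p K n) {t : ℤ}
    (ht : ¬ (0 ≤ t ∧ t < n)) : x t = 0 := by
  by_contra h
  exact ht (hx.2 t h)

theorem blocks_injOn (n : ℕ) :
    Set.InjOn (fun (x : ℤ → Fin (K + 1)) (i : Fin n) => x (i : ℕ)) (blocks p K n) := by
  intro x hx y hy h
  funext t
  by_cases ht : 0 ≤ t ∧ t < n
  · have := congrFun h ⟨t.toNat, by omega⟩
    simpa [Int.toNat_of_nonneg ht.1] using this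
  · rw [blocks_eq_zero hx ht, blocks_eq_zero hy ht]

theorem blocks_finite (n : ℕ) : (blocks p K n).Finite :=
  Set.Finite.of_injOn (Set.mapsTo_univ _ _) (blocks_injOn n) Set.finite_univ

theorem zero_mem_blocks (n : ℕ) : (0 : ℤ → Fin (K + 1)) ∈ blocks p K n :=
  ⟨by simpa using adm_empty p, by simp⟩

theorem blocks_ncard_pos (n : ℕ) : 0 < (blocks p K n).ncard :=
  (Set.ncard_pos (blocks_finite n)).2 ⟨0, zero_mem_blocks n⟩

theorem blocks_mono {m n : ℕ} (h : m ≤ n) : blocks p K m ⊆ blocks p K n :=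
  fun x hx => ⟨hx.1, fun t ht => by have := hx.2 t ht; omega⟩

theorem blocks_ncard_mono {m n : ℕ} (h : m ≤ n) : (blocks p K m).ncard ≤ (blocks p K n).ncard :=
  Set.ncard_le_ncard (blocks_mono h) (blocks_finite n)

theorem blocks_ncard_add_le (m n : ℕ) :
    (blocks p K (m + n)).ncard ≤ (blocks p K m).ncard * (blocks p K n).ncard := by
  rw [← Set.ncard_prod]
  refine Set.ncard_le_ncard_of_injOn (fun x => (fun t => if t < m then x t else 0,
    fun t => if 0 ≤ t then x (t + m) else 0)) ?_ ?_ ((blocks_finite m).prod (blocks_finite n))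
  · intro x hx
    refine ⟨⟨hx.1.subset fun t ht => ?_, fun t ht => ?_⟩,
      ⟨(hx.1.shift m).subset fun t ht => ?_, fun t ht => ?_⟩⟩
    · simp only [Set.mem_ofPred_eq] at ht ⊢; split_ifs at ht <;> simp_all
    · simp only [ne_eq] at ht
      split_ifs at ht with h1
      · exact ⟨(hx.2 t ht).1, h1⟩
      · simp at ht
    · simp only [Set.mem_ofPred_eq] at ht ⊢; split_ifs at ht <;> simp_all
    · simp only [ne_eq] at ht
      split_ifs at ht with h1
      · have := (hx.2 _ ht).2; push_cast at this; exact ⟨h1, by omega⟩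
      · simp at ht
  · intro x hx y hy h
    funext t
    simp only [Prod.mk.injEq] at h
    by_cases ht : t < m
    · simpa [ht] using congrFun h.1 t
    · have := congrFun h.2 (t - m)
      simpa [not_lt.1 ht] using this

/-- Two blocks are concatenated with `c` zeros in between; the last position `a - 1` of the first
and the first position `a + c` of the second differ by more than `c`, as `Adm.union` requires. -/
theorem blocks_ncard_mul_le (hmono : Monotone p) {c : ℕ}
    (hglue : ∀ a b, p a + p b ≤ p (a + b + c)) (a b : ℕ) :
    (blocks p K a).ncard * (blocks p K b).ncard ≤ (blocks p K (a + b + c)).ncard := by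
  rw [← Set.ncard_prod]
  refine Set.ncard_le_ncard_of_injOn
    (fun z : (ℤ → Fin (K + 1)) × (ℤ → Fin (K + 1)) => fun t : ℤ =>
      if t < a then z.1 t else z.2 (t + -(a + c))) ?_ ?_ (blocks_finite _)
  · rintro ⟨x, y⟩ ⟨hx, hy⟩
    refine ⟨?_, fun t ht => ?_⟩
    · refine (Adm.union hmono (n := max a b) (c := c) (fun a b _ _ => hglue a b) hx.1
        (hy.1.shift (-(a + c))) ?_ ?_ ?_).subset ?_
      · intro s hs t ht
        have := hx.2 s hs; have := hx.2 t ht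
        simp only at *; omega
      · intro s hs t ht
        have := hy.2 _ hs; have := hy.2 _ ht
        simp only at *; omega
      · intro s hs t ht
        have := hx.2 s hs; have := hy.2 _ ht
        rw [abs_sub_comm, abs_of_nonneg] <;> simp only at * <;> omega
      · intro t ht
        simp only [Set.mem_ofPred_eq, Set.mem_union] at ht ⊢
        split_ifs at ht
        · exact Or.inl ht
        · exact Or.inr ht
    · simp only [ne_eq] at ht
      split_ifs at ht with h1
      · have := hx.2 t ht; simp only at *; push_cast; omega
      · have := hy.2 _ ht; simp only at *; push_cast; omega
  · rintro ⟨x, y⟩ ⟨hx, hy⟩ ⟨x', y'⟩ ⟨hx', hy'⟩ h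
    simp only at hx hy hx' hy' h
    refine Prod.ext (funext fun t => ?_) (funext fun t => ?_)
    · by_cases ht : t < a
      · simpa [ht] using congrFun h t
      · simp only
        rw [blocks_eq_zero hx (by omega), blocks_eq_zero hx' (by omega)]
    · by_cases ht : 0 ≤ t
      · have := congrFun h (t + (a + c))
        rwa [if_neg (by omega), if_neg (by omega), add_neg_cancel_right] at this
      · simp only
        rw [blocks_eq_zero hy (by omega), blocks_eq_zero hy' (by omega)]

theorem blocks_ncard_pow_le (hmono : Monotone p) {c : ℕ}
    (hglue : ∀ a b, p a + p b ≤ p (a + b + c)) (n q : ℕ) :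
    (blocks p K n).ncard ^ q ≤ (blocks p K (q * (n + c))).ncard := by
  induction q with
  | zero => simpa using Nat.succ_le_of_lt (blocks_ncard_pos (p := p) (K := K) 0)
  | succ q ih =>
    rw [pow_succ]
    refine (Nat.mul_le_mul_right _ ih).trans ((blocks_ncard_mul_le hmono hglue _ _).trans ?_)
    exact blocks_ncard_mono (by ring_nf; omega)

theorem blocks_ncard_one (hp : p 1 = 1) (hmono : Monotone p) : K + 1 ≤ (blocks p K 1).ncard := by
  have h1 : (Set.univ : Set (Fin (K + 1))).ncard = K + 1 := by simp [Set.ncard_univ]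
  refine h1.symm.le.trans ?_
  refine Set.ncard_le_ncard_of_injOn (fun a t => if t = 0 then a else 0) ?_ ?_ (blocks_finite _)
  · intro a _
    have h0 : ∀ t : ℤ, (if t = 0 then a else 0) ≠ 0 → t = 0 := by
      intro t ht; by_contra h; simp [h] at ht
    refine ⟨fun F m hF hm => ?_, fun t ht => by rw [h0 t ht]; simp⟩
    rcases F.eq_empty_or_nonempty with rfl | ⟨s, hs⟩
    · simp
    · have hm1 : 1 ≤ m := by have := hm s hs s hs; omega
      refine le_trans ?_ (hmono hm1)
      rw [hp]
      exact Finset.card_le_one.2 fun s hs t ht => (h0 s (hF hs)).trans (h0 t (hF ht)).symm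
  · intro a _ b _ h
    simpa using congrFun h 0

/-- A Chernoff bound for the number of admissible blocks. -/
theorem blocks_ncard_mul_pow_le {t : ℝ} (ht0 : 0 ≤ t) (ht1 : t ≤ 1) (n : ℕ) :
    ((blocks p K n).ncard : ℝ) * t ^ p n ≤ (1 + K * t) ^ n := by
  classical
  set W : Finset (Fin n → Fin (K + 1)) :=
    Finset.univ.filter fun w => (Finset.univ.filter fun i => w i ≠ 0).card ≤ p n with hW
  have h1 : (blocks p K n).ncard ≤ W.card := by
    rw [← Set.ncard_coe_finset]
    refine Set.ncard_le_ncard_of_injOn _ (fun x hx => ?_) (blocks_injOn n) W.finite_toSet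
    simp only [hW, Finset.coe_filter, Finset.mem_univ, true_and, Set.mem_ofPred_eq]
    rw [← Finset.card_image_of_injective (f := fun i : Fin n => ((i : ℕ) : ℤ)) _
      (fun i j h => by simpa [Fin.ext_iff] using h)]
    refine hx.1 _ n ?_ ?_
    · intro s hs
      obtain ⟨i, hi, rfl⟩ := by simpa using hs
      exact hi
    · simp only [Finset.mem_image]
      rintro _ ⟨i, _, rfl⟩ _ ⟨j, _, rfl⟩
      omega
  -- Generating function of all words, each nonzero letter having weight `t`; an admissible block
  -- has at most `p n` such letters, hence weight at least `t ^ p n`.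
  have h2 : (1 + K * t) ^ n = ∑ w : Fin n → Fin (K + 1), ∏ i, if w i ≠ 0 then t else 1 := by
    rw [← Fintype.sum_pow (fun a : Fin (K + 1) => if a ≠ 0 then t else 1) n]
    congr 1
    rw [Fin.sum_univ_succ]
    simp [Fin.succ_ne_zero]
  rw [h2]
  calc ((blocks p K n).ncard : ℝ) * t ^ p n ≤ W.card * t ^ p n := by gcongr
    _ = ∑ w ∈ W, t ^ p n := by simp
    _ ≤ ∑ w ∈ W, ∏ i, (if w i ≠ 0 then t else 1) := by
      refine Finset.sum_le_sum fun w hw => ?_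
      rw [Finset.prod_ite]
      simp only [Finset.prod_const, one_pow, mul_one]
      exact pow_le_pow_of_le_one ht0 ht1 (by simpa [hW] using hw)
    _ ≤ _ := by
      refine Finset.sum_le_sum_of_subset_of_nonneg (Finset.filter_subset _ _) fun w _ _ => ?_
      exact Finset.prod_nonneg fun i _ => by split_ifs <;> simp [ht0]

end blocks

/-! ### Growth rate of the number of blocks. -/

/-- The binary logarithm of the number of admissible blocks of length `n`. -/
noncomputable def logBlocks (p : ℕ → ℕ) (K n : ℕ) : ℝ :=
  Real.logb 2 ((blocks p K n).ncard : ℝ)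

section logBlocks

variable {p : ℕ → ℕ} {K : ℕ}

theorem logBlocks_nonneg (n : ℕ) : 0 ≤ logBlocks p K n :=
  Real.logb_nonneg one_lt_two (by exact_mod_cast blocks_ncard_pos n)

theorem subadditive_logBlocks : Subadditive (logBlocks p K) := by
  intro m n
  have hm : (0 : ℝ) < (blocks p K m).ncard := by exact_mod_cast blocks_ncard_pos m
  have hn : (0 : ℝ) < (blocks p K n).ncard := by exact_mod_cast blocks_ncard_pos n
  have hmn : (0 : ℝ) < (blocks p K (m + n)).ncard := by exact_mod_cast blocks_ncard_pos (m + n)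
  rw [logBlocks, logBlocks, logBlocks, ← Real.logb_mul hm.ne' hn.ne']
  exact Real.logb_le_logb_of_le one_lt_two hmn (by exact_mod_cast blocks_ncard_add_le m n)

theorem bddBelow_logBlocks : BddBelow (Set.range fun n => logBlocks p K n / n) :=
  ⟨0, by rintro _ ⟨n, rfl⟩; exact div_nonneg (logBlocks_nonneg n) (by positivity)⟩

theorem tendsto_logBlocks :
    Tendsto (fun n => logBlocks p K n / n) atTop (𝓝 (subadditive_logBlocks (p := p) (K := K)).lim) :=
  subadditive_logBlocks.tendsto_lim bddBelow_logBlocks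

theorem lim_le_logBlocks_div {n : ℕ} (hn : n ≠ 0) :
    (subadditive_logBlocks (p := p) (K := K)).lim ≤ logBlocks p K n / n :=
  subadditive_logBlocks.lim_le_div bddBelow_logBlocks hn

/-- When one gap `c` suffices at all lengths, blocks of length `n` separated by `c` zeros can be
chosen freely and repeated indefinitely. -/
theorem logBlocks_div_le_lim (hmono : Monotone p) {c : ℕ}
    (hglue : ∀ a b, p a + p b ≤ p (a + b + c)) {n : ℕ} (hn : n ≠ 0) :
    logBlocks p K n / (n + c) ≤ (subadditive_logBlocks (p := p) (K := K)).lim := by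
  have hpos : 0 < n + c := by omega
  have hsub : Tendsto (fun q : ℕ => q * (n + c)) atTop atTop :=
    tendsto_id.atTop_mul_const' hpos
  refine ge_of_tendsto (tendsto_logBlocks.comp hsub) ?_
  filter_upwards [eventually_gt_atTop 0] with q hq
  have hq0 : (0 : ℝ) < q := by exact_mod_cast hq
  have hc0 : (0 : ℝ) < (n : ℝ) + c := by exact_mod_cast hpos
  have hb : (0 : ℝ) < (blocks p K n).ncard := by exact_mod_cast blocks_ncard_pos n
  have h1 : (q : ℝ) * logBlocks p K n ≤ logBlocks p K (q * (n + c)) := by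
    rw [logBlocks, ← Real.logb_pow]
    exact Real.logb_le_logb_of_le one_lt_two (by positivity)
      (by exact_mod_cast blocks_ncard_pow_le hmono hglue n q)
  simp only [Function.comp_apply]
  push_cast
  rw [div_le_div_iff₀ hc0 (by positivity)]
  nlinarith

/-- If the density of the profile vanishes then so does the growth rate of the blocks. -/
theorem lim_eq_zero (h0 : Tendsto (fun m : ℕ => (p m : ℝ) / m) atTop (𝓝 0)) :
    (subadditive_logBlocks (p := p) (K := K)).lim = 0 := by
  refine le_antisymm ?_ (ge_of_tendsto tendsto_logBlocks (Eventually.of_forall fun n =>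
    div_nonneg (logBlocks_nonneg n) (by positivity)))
  -- In the Chernoff bound for fixed `t`, the term `p n / n * logb 2 t` disappears as `n → ∞`;
  -- afterwards `t → 0`.
  have key : ∀ t : ℝ, 0 < t → t ≤ 1 →
      (subadditive_logBlocks (p := p) (K := K)).lim ≤ Real.logb 2 (1 + K * t) := by
    intro t ht0 ht1
    have hlim : Tendsto (fun n : ℕ => Real.logb 2 (1 + K * t) - (p n : ℝ) / n * Real.logb 2 t) atTop
        (𝓝 (Real.logb 2 (1 + K * t) - 0 * Real.logb 2 t)) :=
      tendsto_const_nhds.sub (h0.mul_const _)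
    rw [zero_mul, sub_zero] at hlim
    refine le_of_tendsto_of_tendsto tendsto_logBlocks hlim ?_
    filter_upwards [eventually_gt_atTop 0] with n hn
    have hn0 : (0 : ℝ) < n := by exact_mod_cast hn
    have hb : (0 : ℝ) < (blocks p K n).ncard := by exact_mod_cast blocks_ncard_pos n
    have h1 := Real.logb_le_logb_of_le one_lt_two (by positivity)
      (blocks_ncard_mul_pow_le (p := p) (K := K) ht0.le ht1 n)
    rw [Real.logb_mul hb.ne' (by positivity), Real.logb_pow, Real.logb_pow] at h1
    rw [div_le_iff₀ hn0, sub_mul]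
    have e : (p n : ℝ) / n * Real.logb 2 t * n = p n * Real.logb 2 t := by field_simp
    rw [e, logBlocks]
    linarith
  have hcont : Tendsto (fun t : ℝ => Real.logb 2 (1 + K * t)) (𝓝[>] 0) (𝓝 0) := by
    have hc : ContinuousAt (fun t : ℝ => Real.logb 2 (1 + K * t)) 0 := by
      refine ContinuousAt.div_const (ContinuousAt.log (by fun_prop) (by simp)) _
    have := hc.tendsto
    simp only [mul_zero, add_zero, Real.logb_one] at this
    exact this.mono_left nhdsWithin_le_nhds
  refine ge_of_tendsto hcont ?_
  filter_upwards [Ioc_mem_nhdsGT (zero_lt_one' ℝ)] with t ht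
  exact key t ht.1 ht.2

end logBlocks

/-! ### The adaptive choice of gaps gives growth rate `α`. -/

/-- The gap function `G` follows the rule of growing, within the bound given by `f`, exactly while
the blocks of the current length stay numerous compared to one of the first terms of `a`. -/
def FollowsRule (f : ℕ → ℕ) (a : ℕ → ℝ) (K : ℕ) (p G : ℕ → ℕ) : Prop :=
  ∀ n, G (n + 1) = G n + 1 ↔
    G n + 1 ≤ f n ∧ ∃ i ≤ n, a i * (n + G n + 1) < logBlocks p K n

namespace IsProfile

variable {f p G : ℕ → ℕ} {a : ℕ → ℝ} {K : ℕ} {α : ℝ}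

/-- An increase at `n` certifies `α * (n + G n + 1) ≤ logBlocks p K n`. If increases recur forever,
this passes to the limit. If there is a last one, the gap stays at `G n + 1`, so the blocks of
length `n` concatenate freely with that gap. If there is none, single letters concatenate freely and
`hK` suffices. -/
theorem le_lim (h : IsProfile p G) (hrule : FollowsRule f a K p G) (hα : 0 < α)
    (hK : α ≤ Real.logb 2 (K + 1)) (ha : IsGLB (Set.range a) α) :
    α ≤ (subadditive_logBlocks (p := p) (K := K)).lim := by
  have hlt : ∀ n, G (n + 1) = G n + 1 → n ≠ 0 ∧ α * (n + G n + 1) ≤ logBlocks p K n := by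
    intro n hn
    obtain ⟨_, i, _, hi⟩ := (hrule n).1 hn
    have h1 : α ≤ a i := ha.1 ⟨i, rfl⟩
    have h2 : α * (n + G n + 1) ≤ a i * (n + G n + 1) := by gcongr
    refine ⟨?_, (h2.trans_lt hi).le⟩
    rintro rfl
    have : logBlocks p K 0 ≤ 0 := by
      have h0 : (blocks p K 0).ncard ≤ 1 := by
        rw [Set.ncard_le_one (blocks_finite 0)]
        intro x hx y hy
        funext t
        rw [blocks_eq_zero hx (by simp), blocks_eq_zero hy (by simp)]
      have h1 := blocks_ncard_pos (p := p) (K := K) 0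
      rw [logBlocks, show (blocks p K 0).ncard = 1 by omega]
      simp
    have : 0 < α * ((0 : ℕ) + G 0 + 1) := by positivity
    linarith
  by_cases hinf : ∃ᶠ n in atTop, G (n + 1) = G n + 1
  · refine ge_of_tendsto_of_frequently tendsto_logBlocks (hinf.mono fun n hn => ?_)
    obtain ⟨hn0, hn1⟩ := hlt n hn
    have : (0 : ℝ) < n := by positivity
    rw [le_div_iff₀ this]
    have : (0 : ℝ) ≤ G n := by positivity
    nlinarith
  · rw [not_frequently, eventually_atTop] at hinf
    have hbound : ∀ c, (∀ n, G n ≤ c) → ∀ n, n ≠ 0 → logBlocks p K n / (n + c) ≤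
        (subadditive_logBlocks (p := p) (K := K)).lim := fun c hc n hn =>
      logBlocks_div_le_lim h.mono
        (fun a b => h.glue_of_le (hc (max a b)) a b (le_max_left _ _) (le_max_right _ _)) hn
    by_cases hex : ∃ n, G (n + 1) = G n + 1
    · obtain ⟨N, hN⟩ := hinf
      obtain ⟨n₀, hn₀⟩ := hex
      -- The last increase.
      obtain ⟨n, hn, hmax⟩ : ∃ n, G (n + 1) = G n + 1 ∧ ∀ m, G (m + 1) = G m + 1 → m ≤ n := by
        classical
        have hb : ∀ m, G (m + 1) = G m + 1 → m ≤ N := fun m hm => by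
          by_contra hlt
          exact hN m (by omega) hm
        exact ⟨Nat.findGreatest (fun m => G (m + 1) = G m + 1) N,
          Nat.findGreatest_spec (P := fun m => G (m + 1) = G m + 1) (hb n₀ hn₀) hn₀,
          fun m hm => Nat.le_findGreatest (hb m hm) hm⟩
      obtain ⟨hn0, hn1⟩ := hlt n hn
      have hconst : ∀ m, G (n + 1 + m) ≤ G n + 1 := by
        intro m
        induction m with
        | zero => simp [hn]
        | succ m ih =>
          rcases h.gap_succ (n + 1 + m) with e | e
          · rw [← add_assoc, e]; exact ih
          · have := hmax _ e; omega
      have hle : ∀ m, G m ≤ G n + 1 := fun m =>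
        (h.gap_mono (by omega : m ≤ n + 1 + m)).trans (hconst m)
      refine le_trans ?_ (hbound _ hle n hn0)
      rw [le_div_iff₀ (by positivity)]
      push_cast
      rw [← add_assoc]
      exact hn1
    · push Not at hex
      have hz : ∀ n, G n ≤ 0 := by
        intro n
        induction n with
        | zero => simp [h.gap_zero]
        | succ n ih =>
          rcases h.gap_succ n with e | e
          · omega
          · exact absurd e (hex n)
      refine le_trans ?_ (hbound 0 hz 1 one_ne_zero)
      simp only [Nat.cast_one, Nat.cast_zero, add_zero, div_one]
      refine hK.trans (Real.logb_le_logb_of_le one_lt_two (by positivity) ?_)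
      exact_mod_cast blocks_ncard_one h.one h.mono

theorem gap_succ_le (h : IsProfile p G) (hrule : FollowsRule f a K p G) (hf : Monotone f) (n : ℕ) :
    G (n + 1) ≤ f n := by
  induction n with
  | zero =>
    rcases h.gap_succ 0 with e | e
    · rw [e, h.gap_zero]; exact Nat.zero_le _
    · rw [e]; exact ((hrule 0).1 e).1
  | succ n ih =>
    rcases h.gap_succ (n + 1) with e | e
    · rw [e]; exact ih.trans (hf (Nat.le_succ n))
    · rw [e]; exact ((hrule (n + 1)).1 e).1

/-- By contradiction: a limit above `α` is positive, so the gap sums are bounded and `G n / n → 0`.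
The test then succeeds for all large `n`, and only the bound by `f` can stop `G` from growing. -/
theorem lim_le (h : IsProfile p G) (hrule : FollowsRule f a K p G) (hα : 0 < α)
    (ha : IsGLB (Set.range a) α) (hf : Monotone f) (hstep : ∀ n, f (n + 1) ≤ f n + 1)
    (hsum : Tendsto (fun N : ℕ => ∑ n ∈ Finset.Icc 1 N, (f n : ℝ) / (n : ℝ) ^ 2) atTop atTop) :
    (subadditive_logBlocks (p := p) (K := K)).lim ≤ α := by
  by_contra! hlt
  set l := (subadditive_logBlocks (p := p) (K := K)).lim with hl
  -- the gap sums are bounded, since otherwise the limit vanishes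
  obtain ⟨B, hB⟩ : ∃ B, ∀ n, gapSum G n ≤ B := by
    by_contra! hB
    have hS : Tendsto (gapSum G) atTop atTop :=
      tendsto_atTop_atTop_of_monotone h.gapSum_mono fun b => (hB b).imp fun n hn => hn.le
    have := lim_eq_zero (K := K) (h.tendsto_div_zero hS)
    linarith
  have hG0 := h.gap_div_tendsto_zero hB
  obtain ⟨β, hβ1, hβ2⟩ := exists_between hlt
  obtain ⟨i, hi⟩ : ∃ i, a i < β := by
    by_contra! hge
    exact absurd (ha.2 (by rintro _ ⟨i, rfl⟩; exact hge i)) (not_le.2 hβ1)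
  have hβ0 : 0 < β := hα.trans hβ1
  have htest : ∀ᶠ n in atTop, ∃ i ≤ n, a i * (n + G n + 1) < logBlocks p K n := by
    have h1 : Tendsto (fun n : ℕ => β * (1 + (G n : ℝ) / n + 1 / n)) atTop
        (𝓝 (β * (1 + 0 + 0))) :=
      ((tendsto_const_nhds.add hG0).add tendsto_one_div_atTop_nhds_zero_nat).const_mul β
    rw [add_zero, add_zero, mul_one] at h1
    filter_upwards [h1.eventually_lt_const hβ2, eventually_ge_atTop (max i 1)] with n hn hni
    have hn0 : (0 : ℝ) < n := by exact_mod_cast (le_max_right _ _).trans hni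
    refine ⟨i, (le_max_left _ _).trans hni, ?_⟩
    have h2 : l ≤ logBlocks p K n / n := lim_le_logBlocks_div (by rintro rfl; simp at hn0)
    calc a i * (n + G n + 1) ≤ β * (n + G n + 1) := by gcongr
      _ = β * (1 + (G n : ℝ) / n + 1 / n) * n := by field_simp
      _ < l * n := by gcongr
      _ ≤ logBlocks p K n := by rwa [le_div_iff₀ hn0] at h2
  obtain ⟨N, hN⟩ := eventually_atTop.1 htest
  have hGf := h.gap_succ_le hrule hf
  have hgrow : ∀ n, N ≤ n → G n + 1 ≤ f n → G (n + 1) = G n + 1 := fun n hn hle =>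
    (hrule n).2 ⟨hle, hN n hn⟩
  -- Once `G` has caught up with `f` it stays equal to it, since `f` grows by at most one per step.
  -- If it never catches up, it increases at every step, contradicting `G n / n → 0`.
  by_cases hcatch : ∃ n, N ≤ n ∧ G (n + 1) = f n
  · obtain ⟨n, hn, e⟩ := hcatch
    have heq : ∀ m, n ≤ m → G (m + 1) = f m := by
      intro m hm
      induction m, hm using Nat.le_induction with
      | base => exact e
      | succ m hm ih =>
        have h1 := hstep m
        have h2 := hf (Nat.le_succ m)
        by_cases hle : G (m + 1) + 1 ≤ f (m + 1)
        · rw [hgrow (m + 1) (by omega) hle]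
          simp only [Nat.succ_eq_add_one] at h2
          omega
        · have := h.gap_mono (Nat.le_succ (m + 1))
          have := hGf (m + 1)
          simp only [Nat.succ_eq_add_one] at *
          omega
    -- the series of `f k / k ^ 2` would be bounded
    have hbd : ∀ m, n + 1 ≤ m → ∑ k ∈ Finset.Ico (n + 1) m, (f k : ℝ) / (k : ℝ) ^ 2 ≤
        2 * (B + G 1) := by
      intro m hm
      have h1 := gapSum_eq G (n := m) (by omega)
      have h2 := hB m
      have h3 : (0 : ℝ) ≤ (G m : ℝ) / m := by positivity
      -- The factor `2` comes from `k * (k + 1) ≤ 2 * k ^ 2` for `k ≥ 1`.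
      have h4 : ∑ k ∈ Finset.Ico (n + 1) m, (f k : ℝ) / (k : ℝ) ^ 2 ≤
          2 * ∑ k ∈ Finset.Ico 1 m, (G (k + 1) : ℝ) / (k * (k + 1)) := by
        rw [Finset.mul_sum]
        refine (Finset.sum_le_sum fun k hk => ?_).trans
          (Finset.sum_le_sum_of_subset_of_nonneg
            (Finset.Ico_subset_Ico_left (by omega : 1 ≤ n + 1)) fun k _ _ => by positivity)
        have hk1 := (Finset.mem_Ico.1 hk).1
        have hk0 : (1 : ℝ) ≤ k := by exact_mod_cast (by omega : 1 ≤ k)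
        rw [heq k (by omega), ← mul_div_assoc, div_le_div_iff₀ (by positivity) (by positivity)]
        have : (0 : ℝ) ≤ f k := by positivity
        nlinarith [mul_nonneg this (mul_nonneg (by linarith : (0 : ℝ) ≤ k)
          (by linarith : (0 : ℝ) ≤ (k : ℝ) - 1))]
      linarith
    obtain ⟨M, hM1, hM⟩ := ((eventually_ge_atTop (n + 1)).and (hsum.eventually_gt_atTop
      (∑ k ∈ Finset.Ico 1 (n + 1), (f k : ℝ) / (k : ℝ) ^ 2 + 2 * (B + G 1)))).exists
    have e2 : Finset.Icc 1 M = Finset.Ico 1 (M + 1) := by ext; simp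
    rw [e2, ← Finset.sum_Ico_consecutive _ (by omega : 1 ≤ n + 1) (by omega : n + 1 ≤ M + 1)] at hM
    linarith [hbd (M + 1) (by omega)]
  · push Not at hcatch
    have hlin : ∀ m, G (N + 1 + m) = G (N + 1) + m := by
      intro m
      induction m with
      | zero => rfl
      | succ m ih =>
        have h1 := hcatch (N + m) (by omega)
        have h2 := hGf (N + m)
        have h3 := hf (Nat.le_succ (N + m))
        simp only [Nat.succ_eq_add_one] at h3
        rw [show N + m + 1 = N + 1 + m by omega] at h1 h2 h3
        rw [← add_assoc, hgrow _ (by omega) (by omega), ih]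
        omega
    have hsub : Tendsto (fun m : ℕ => N + 1 + m) atTop atTop :=
      tendsto_atTop_mono (fun m => by simp) tendsto_id
    obtain ⟨m, hm, hm1⟩ := (((hG0.comp hsub).eventually_lt_const
      (show (0 : ℝ) < 1 / 2 by norm_num)).and (eventually_gt_atTop (N + 1))).exists
    simp only [Function.comp_apply, hlin] at hm
    rw [div_lt_iff₀ (by positivity)] at hm
    have hm2 : (N : ℝ) + 1 < m := by exact_mod_cast hm1
    have : (0 : ℝ) ≤ G (N + 1) := by positivity
    push_cast at hm
    linarith

/-- A profile whose gaps follow the rule for `a` has growth rate `inf a`. -/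
theorem tendsto_logBlocks_div (h : IsProfile p G) (hrule : FollowsRule f a K p G) (hα : 0 < α)
    (hK : α ≤ Real.logb 2 (K + 1)) (ha : IsGLB (Set.range a) α) (hf : Monotone f)
    (hstep : ∀ n, f (n + 1) ≤ f n + 1)
    (hsum : Tendsto (fun N : ℕ => ∑ n ∈ Finset.Icc 1 N, (f n : ℝ) / (n : ℝ) ^ 2) atTop atTop) :
    Tendsto (fun n => logBlocks p K n / n) atTop (𝓝 α) := by
  rw [le_antisymm (h.le_lim hrule hα hK ha) (h.lim_le hrule hα ha hf hstep hsum)]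
  exact tendsto_logBlocks

end IsProfile

/-! ### The subshift in dimension `d + 1`: irreducibility, language, entropy. -/

/-- The configurations on `ℤ ^ (d + 1)` in which the nonzero symbols of each row in the first
direction form a set that is admissible for `p`. -/
def densityShift (d K : ℕ) (p : ℕ → ℕ) : ZSubshift (d + 1) (K + 1) where
  carrier := {x | ∀ r : Fin d → ℤ, Adm p {t | x (Fin.cons t r) ≠ 0}}
  isClosed := by
    have e : {x : (Fin (d + 1) → ℤ) → Fin (K + 1) | ∀ r : Fin d → ℤ,
        Adm p {t | x (Fin.cons t r) ≠ 0}} = ⋂ (r : Fin d → ℤ) (F : Finset ℤ) (m : ℕ)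
          (_ : (∀ s ∈ F, ∀ t ∈ F, s - t < m) ∧ p m < F.card),
          ⋃ t ∈ F, {x | x (Fin.cons t r) = 0} := by
      ext x
      simp only [Set.mem_ofPred_eq, Set.mem_iInter, Set.mem_iUnion, Adm]
      refine forall_congr' fun r => forall_congr' fun F => forall_congr' fun m => ?_
      constructor
      · rintro h ⟨h1, h2⟩
        by_contra! h3
        exact absurd (h (fun t ht => h3 t ht) h1) (not_le.2 h2)
      · intro h h1 h2
        by_contra! h3
        obtain ⟨t, ht, e⟩ := h ⟨h2, h3⟩
        exact h1 ht e
    rw [e]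
    refine isClosed_iInter fun r => isClosed_iInter fun F => isClosed_iInter fun m =>
      isClosed_iInter fun _ => F.finite_toSet.isClosed_biUnion fun t _ => ?_
    exact isClosed_singleton.preimage (continuous_apply _)
  mapsTo := by
    intro g x hx r
    refine ((hx (Fin.tail g + r)).shift (g 0)).subset fun t ht => ?_
    simp only [Set.mem_ofPred_eq, shift_apply] at ht ⊢
    convert ht using 3
    funext i
    refine Fin.cases ?_ (fun j => ?_) i
    · simp [add_comm]
    · simp [Fin.tail]

section densityShift

variable {d K : ℕ} {p : ℕ → ℕ}

theorem densityShift_nonempty : (densityShift d K p).carrier.Nonempty :=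
  ⟨0, fun r => by simpa using adm_empty p⟩

theorem dist_cons_cons (r : Fin d → ℤ) (s t : ℤ) :
    dist (Fin.cons s r : Fin (d + 1) → ℤ) (Fin.cons t r : Fin (d + 1) → ℤ) = |((s - t : ℤ) : ℝ)| := by
  refine le_antisymm ((dist_pi_le_iff (abs_nonneg _)).2 fun i => ?_) ?_
  · refine Fin.cases ?_ (fun j => ?_) i
    · simp [Int.dist_eq]
    · simp
  · have := dist_le_pi_dist (Fin.cons s r : Fin (d + 1) → ℤ) (Fin.cons t r : Fin (d + 1) → ℤ) 0
    simpa [Int.dist_eq] using this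

/-- The two patterns are completed by zeros and glued row by row. A set of diameter at most `n` fits
in a window of length `n + 1`, which explains the shift of index in `hf`. -/
theorem isIrreducible_densityShift {G f : ℕ → ℕ} (h : IsProfile p G) (hf : ∀ n, G (n + 1) ≤ f n) :
    IsIrreducible f (densityShift d K p) := by
  classical
  intro n U V hU hV hUV u ⟨x, hx, hxu⟩ v ⟨y, hy, hyv⟩
  have hdisj : ∀ i ∈ V, i ∉ U := by
    intro i hi hi'
    have := hUV i hi' i hi
    rw [dist_self] at this
    exact absurd this (not_lt.2 (by positivity))
  refine ⟨fun i => if i ∈ U then x i else if i ∈ V then y i else 0, fun r => ?_,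
    fun i => by simp [hxu], fun j => by simp [hdisj j.1 j.2, hyv]⟩
  refine (Adm.union h.mono (n := n) (c := f n) (fun a b => h.glue_of_le (hf n) a b)
    (S := {t | x (Fin.cons t r) ≠ 0 ∧ Fin.cons t r ∈ U})
    (T := {t | y (Fin.cons t r) ≠ 0 ∧ Fin.cons t r ∈ V})
    ((hx r).subset fun t ht => ht.1) ((hy r).subset fun t ht => ht.1) ?_ ?_ ?_).subset ?_
  · intro s hs t ht
    have := hU _ hs.2 _ ht.2
    rw [dist_cons_cons] at this
    exact_mod_cast (le_abs_self _).trans this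
  · intro s hs t ht
    have := hV _ hs.2 _ ht.2
    rw [dist_cons_cons] at this
    exact_mod_cast (le_abs_self _).trans this
  · intro s hs t ht
    have := hUV _ hs.2 _ ht.2
    rw [dist_cons_cons] at this
    exact_mod_cast this
  · intro t ht
    simp only [Set.mem_ofPred_eq, Set.mem_union] at ht ⊢
    split_ifs at ht with h1 h2
    · exact Or.inl ⟨ht, h1⟩
    · exact Or.inr ⟨ht, h2⟩
    · simp at ht

/-- Filling with zeros extends every locally admissible pattern, so membership in the language is a
finite check. -/
theorem mem_language_densityShift {w : List ((Fin (d + 1) → ℤ) × Fin (K + 1))} :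
    w ∈ language (densityShift d K p) ↔
      (∀ a ∈ w, ∀ b ∈ w, a.1 = b.1 → a.2 = b.2) ∧
      ∀ r : Fin d → ℤ, Adm p {t | ∃ a, a ≠ 0 ∧ (Fin.cons t r, a) ∈ w} := by
  classical
  rw [mem_language_iff]
  constructor
  · rintro ⟨x, hx, hw⟩
    refine ⟨fun a ha b hb e => by rw [← hw a ha, ← hw b hb, e], fun r => (hx r).subset ?_⟩
    rintro t ⟨a, ha, hmem⟩
    have := hw _ hmem
    simp only [Set.mem_ofPred_eq] at this ⊢
    rwa [this]
  · rintro ⟨hcons, hadm⟩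
    refine ⟨fun i => if h : ∃ a, (i, a) ∈ w then h.choose else 0, fun r => (hadm r).subset ?_, ?_⟩
    · intro t ht
      simp only [Set.mem_ofPred_eq] at ht ⊢
      split_ifs at ht with h
      · exact ⟨_, ht, h.choose_spec⟩
      · simp at ht
    · intro a ha
      have h : ∃ b, (a.1, b) ∈ w := ⟨a.2, ha⟩
      simp only [h, dite_true]
      exact hcons _ h.choose_spec a ha rfl

theorem mem_box {n : ℕ} {i : Fin (d + 1) → ℤ} :
    i ∈ box (d + 1) n ↔ (0 ≤ i 0 ∧ i 0 < n) ∧ ∀ j : Fin d, 0 ≤ i j.succ ∧ i j.succ < n := by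
  simp [box, Fintype.mem_piFinset, Fin.forall_fin_succ]

/-- A pattern on the cube is an independent choice of one block for each of its `n ^ d` rows. -/
theorem ncard_languageOn_box (n : ℕ) :
    (languageOn (densityShift d K p) (box (d + 1) n)).ncard = (blocks p K n).ncard ^ n ^ d := by
  classical
  have hfin : Finite (blocks p K n) := blocks_finite n
  let φ : languageOn (densityShift d K p) (box (d + 1) n) → ((Fin d → Fin n) → blocks p K n) :=
    fun u r => ⟨fun t => if h : (Fin.cons t fun j => ((r j : ℕ) : ℤ)) ∈ box (d + 1) n
      then u.1 ⟨_, h⟩ else 0, by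
        obtain ⟨x, hx, hxu⟩ := u.2
        refine ⟨(hx fun j => ((r j : ℕ) : ℤ)).subset fun t ht => ?_, fun t ht => ?_⟩
        · simp only [Set.mem_ofPred_eq] at ht ⊢
          split_ifs at ht with h
          · rw [← hxu ⟨_, h⟩] at ht; exact ht
          · simp at ht
        · simp only [ne_eq] at ht
          split_ifs at ht with h
          · simpa using (mem_box.1 h).1
          · simp at ht⟩
  have hφ : Function.Bijective φ := by
    constructor
    · intro u u' h
      refine Subtype.ext (funext fun ⟨i, hi⟩ => ?_)
      have hi' := mem_box.1 hi
      have e : (Fin.cons (i 0) fun j => (((i j.succ).toNat : ℕ) : ℤ)) = i := by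
        funext j
        refine Fin.cases ?_ (fun j => ?_) j
        · simp
        · simpa using (hi'.2 j).1
      have h1 := congrFun (congrArg Subtype.val
        (congrFun h fun j => ⟨(i j.succ).toNat, by have := hi'.2 j; omega⟩)) (i 0)
      simp only [φ] at h1
      simpa only [e, hi, dite_true] using h1
    · intro B
      let x : (Fin (d + 1) → ℤ) → Fin (K + 1) := fun i =>
        if h : ∀ j : Fin d, 0 ≤ i j.succ ∧ i j.succ < n then
          (B fun j => ⟨(i j.succ).toNat, by have := h j; omega⟩).1 (i 0) else 0
      have hx : x ∈ (densityShift d K p).carrier := by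
        intro r
        by_cases h : ∀ j : Fin d, 0 ≤ r j ∧ r j < n
        · refine (B fun j => ⟨(r j).toNat, by have := h j; omega⟩).2.1.subset fun t ht => ?_
          simpa [x, h] using ht
        · refine (adm_empty p).subset fun t ht => ?_
          simp [x, h] at ht
      refine ⟨⟨fun i => x i, x, hx, fun _ => rfl⟩, ?_⟩
      funext r
      refine Subtype.ext (funext fun t => ?_)
      simp only [φ]
      split_ifs with h
      · simp [x]
      · refine (blocks_eq_zero (B r).2 fun ht => h ?_).symm
        rw [mem_box]
        simpa using ht
  have := Nat.card_congr (Equiv.ofBijective φ hφ)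
  rw [Nat.card_fun, Nat.card_fun] at this
  rw [← Nat.card_coe_set_eq, this, Nat.card_coe_set_eq]
  simp

theorem hasEntropy_densityShift {α : ℝ}
    (h : Tendsto (fun n => logBlocks p K n / n) atTop (𝓝 α)) :
    HasEntropy (densityShift d K p) α := by
  refine h.congr' ?_
  filter_upwards [eventually_gt_atTop 0] with n hn
  have hn0 : (n : ℝ) ≠ 0 := by positivity
  rw [ncard_languageOn_box]
  push_cast
  rw [Real.logb_pow, logBlocks]
  push_cast
  field_simp
  ring

end densityShift

/-! ### Auxiliary computable functions. -/

section primrec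

variable {α β σ : Type*} [Primcodable α] [Primcodable β] [Primcodable σ]

theorem primrecPred_forall_mem {L : α → List β} {R : α → β → Prop} (hL : Primrec L)
    (hR : PrimrecRel R) : PrimrecPred fun a => ∀ b ∈ L a, R a b :=
  PrimrecRel.comp (PrimrecRel.forall_mem_list hR.swap) hL Primrec.id

theorem primrecPred_exists_mem {L : α → List β} {R : α → β → Prop} (hL : Primrec L)
    (hR : PrimrecRel R) : PrimrecPred fun a => ∃ b ∈ L a, R a b :=
  PrimrecRel.comp (PrimrecRel.exists_mem_list hR.swap) hL Primrec.id

theorem primrec_filter {L : α → List β} {R : α → β → Prop} [∀ a b, Decidable (R a b)]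
    (hL : Primrec L) (hR : PrimrecRel R) : Primrec fun a => (L a).filter fun b => R a b := by
  let : DecidableRel fun b a => R a b := fun b a => inferInstanceAs (Decidable (R a b))
  exact (PrimrecRel.listFilter (R := fun b a => R a b) hR.swap).comp hL Primrec.id

theorem primrec_nat_pow : Primrec₂ ((· ^ ·) : ℕ → ℕ → ℕ) :=
  Primrec₂.unpaired'.1 Nat.Primrec.pow

theorem int_encode_ofNat (n : ℕ) : Encodable.encode (Int.ofNat n) = 2 * n := by
  change Nat.bit false n = _
  simp [Nat.bit]

theorem int_encode_negSucc (n : ℕ) : Encodable.encode (Int.negSucc n) = 2 * n + 1 := by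
  change Nat.bit true n = _
  simp [Nat.bit]

theorem primrec_int_toNat : Primrec Int.toNat := by
  have h : Primrec fun z : ℤ => if Encodable.encode z % 2 = 0 then Encodable.encode z / 2 else 0 :=
    Primrec.ite (Primrec.eq.comp (Primrec.nat_mod.comp Primrec.encode (Primrec.const 2))
      (Primrec.const 0)) (Primrec.nat_div.comp Primrec.encode (Primrec.const 2)) (Primrec.const 0)
  refine h.of_eq fun z => ?_
  rcases z with n | n
  · rw [int_encode_ofNat, if_pos (by omega), Int.ofNat_eq_natCast, Int.toNat_natCast]; omega
  · rw [int_encode_negSucc, if_neg (by omega)]; rfl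

theorem primrec_int_neg_toNat : Primrec fun z : ℤ => (-z).toNat := by
  have h : Primrec fun z : ℤ =>
      if Encodable.encode z % 2 = 0 then 0 else Encodable.encode z / 2 + 1 :=
    Primrec.ite (Primrec.eq.comp (Primrec.nat_mod.comp Primrec.encode (Primrec.const 2))
      (Primrec.const 0)) (Primrec.const 0)
      (Primrec.succ.comp (Primrec.nat_div.comp Primrec.encode (Primrec.const 2)))
  refine h.of_eq fun z => ?_
  rcases z with n | n
  · rw [int_encode_ofNat, if_pos (by omega), Int.ofNat_eq_natCast]; omega
  · rw [int_encode_negSucc, if_neg (by omega), Int.neg_negSucc, Int.toNat_natCast]; omega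

theorem primrec_int_sub_toNat : Primrec₂ fun a b : ℤ => (a - b).toNat := by
  have h : Primrec₂ fun a b : ℤ => (a.toNat + (-b).toNat) - (b.toNat + (-a).toNat) :=
    Primrec.nat_sub.comp
      (Primrec.nat_add.comp (primrec_int_toNat.comp Primrec.fst)
        (primrec_int_neg_toNat.comp Primrec.snd))
      (Primrec.nat_add.comp (primrec_int_toNat.comp Primrec.snd)
        (primrec_int_neg_toNat.comp Primrec.fst))
  exact h.of_eq fun a b => by omega

theorem computable_map_range {F : σ → ℕ → β} (hF : Computable₂ F) :
    Computable₂ fun s n => (List.range n).map (F s) := by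
  have h : Computable₂ fun (q : σ × ℕ) (y : ℕ × List β) => y.2 ++ [F q.1 y.1] :=
    Computable.list_concat.comp (Computable.snd.comp Computable.snd)
      (hF.comp (Computable.fst.comp Computable.fst) (Computable.fst.comp Computable.snd))
  refine (Computable.nat_rec Computable.snd (Computable.const []) h).of_eq fun q => ?_
  rcases q with ⟨s, n⟩
  induction n with
  | zero => rfl
  | succ n ih => simp only at ih ⊢; rw [ih, List.range_succ, List.map_append]; rfl

end primrec

/-! ### Computing the profile and the gaps by a joint recursion. -/

/-- The value of the profile at `l.length`, if `l` lists the earlier values and gaps. -/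
def nextValue (l : List (ℕ × ℕ)) : ℕ :=
  ((List.range l.length).flatMap fun a => (List.range (a + 1)).map fun b =>
    if a + b + (l.getD a (0, 0)).2 ≤ l.length then (l.getD a (0, 0)).1 + (l.getD b (0, 0)).1
    else 0).foldr max (max 1 (l.getD (l.length - 1) (0, 0)).1)

/-- All words of length `n`. -/
def words (K : ℕ) : ℕ → List (List (Fin (K + 1)))
  | 0 => [[]]
  | n + 1 => (words K n).flatMap fun w => (List.finRange (K + 1)).map fun a => a :: w

/-- The word `w` is admissible for the profile listed in `l`. -/
def GoodWord {K : ℕ} (l : List (ℕ × ℕ)) (w : List (Fin (K + 1))) : Prop :=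
  ∀ i ∈ List.range w.length, ∀ m ∈ List.range (w.length + 1),
    ((List.range w.length).filter fun t => i ≤ t ∧ t < i + m ∧ w.getD t 0 ≠ 0).length
      ≤ (l.getD m (0, 0)).1

instance {K : ℕ} (l : List (ℕ × ℕ)) (w : List (Fin (K + 1))) : Decidable (GoodWord l w) := by
  unfold GoodWord; infer_instance

/-- The number of admissible words of length `l.length - 1`. -/
def wordCount (K : ℕ) (l : List (ℕ × ℕ)) : ℕ :=
  ((words K (l.length - 1)).filter fun w => GoodWord l w).length

/-- The gap at `l.length`, if `l` lists the earlier values and gaps, the new gap is bounded by `c`,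
and `q` lists the fractions to compare with. -/
def nextGap (K : ℕ) (c : ℕ) (q : List (ℕ × ℕ)) (l : List (ℕ × ℕ)) : ℕ :=
  if (l.getD (l.length - 1) (0, 0)).2 + 1 ≤ c ∧
      ∃ x ∈ q, 2 ^ (x.1 * (l.length + (l.getD (l.length - 1) (0, 0)).2)) < wordCount K l ^ x.2
  then (l.getD (l.length - 1) (0, 0)).2 + 1 else (l.getD (l.length - 1) (0, 0)).2

/-- The list of the first `n` values and gaps. -/
def table (f : ℕ → ℕ) (q : ℕ → ℕ × ℕ) (K : ℕ) : ℕ → List (ℕ × ℕ)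
  | 0 => []
  | n + 1 => table f q K n ++ [if n = 0 then (0, 0) else (nextValue (table f q K n),
      nextGap K (f (n - 1)) ((List.range n).map q) (table f q K n))]

theorem primrec_nextValue : Primrec nextValue := by
  have hval : Primrec₂ fun (l : List (ℕ × ℕ)) (a : ℕ) => l.getD a (0, 0) := Primrec.list_getD _
  refine Primrec.list_foldr (h := fun _ x => max x.1 x.2) ?_ ?_ ?_
  · refine Primrec.list_flatMap (Primrec.list_range.comp Primrec.list_length) ?_
    refine Primrec.list_map (Primrec.list_range.comp (Primrec.succ.comp Primrec.snd)) ?_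
    have hl : Primrec fun x : (List (ℕ × ℕ) × ℕ) × ℕ => x.1.1 := Primrec.fst.comp Primrec.fst
    have ha : Primrec fun x : (List (ℕ × ℕ) × ℕ) × ℕ => x.1.2 := Primrec.snd.comp Primrec.fst
    have hb : Primrec fun x : (List (ℕ × ℕ) × ℕ) × ℕ => x.2 := Primrec.snd
    exact Primrec.ite (Primrec.nat_le.comp (Primrec.nat_add.comp (Primrec.nat_add.comp ha hb)
      (Primrec.snd.comp (hval.comp hl ha))) (Primrec.list_length.comp hl))
      (Primrec.nat_add.comp (Primrec.fst.comp (hval.comp hl ha))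
        (Primrec.fst.comp (hval.comp hl hb))) (Primrec.const 0)
  · exact Primrec.nat_max.comp (Primrec.const 1) (Primrec.fst.comp (hval.comp Primrec.id
      (Primrec.nat_sub.comp Primrec.list_length (Primrec.const 1))))
  · exact Primrec.nat_max.comp (Primrec.fst.comp Primrec.snd) (Primrec.snd.comp Primrec.snd)

theorem primrec_words (K : ℕ) : Primrec (words K) := by
  have h : Primrec (Nat.rec [[]] fun _ (l : List (List (Fin (K + 1)))) =>
      l.flatMap fun w => (List.finRange (K + 1)).map fun a => a :: w) := by
    refine Primrec.nat_rec₁ _ (Primrec.list_flatMap Primrec.snd ?_)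
    exact Primrec.list_map (Primrec.const _)
      (Primrec.list_cons.comp Primrec.snd (Primrec.snd.comp Primrec.fst))
  refine h.of_eq fun n => ?_
  induction n with
  | zero => rfl
  | succ n ih => simp only [words]; rw [← ih]

theorem primrecRel_goodWord (K : ℕ) :
    PrimrecRel fun (l : List (ℕ × ℕ)) (w : List (Fin (K + 1))) => GoodWord l w := by
  have hlen : Primrec fun x : List (ℕ × ℕ) × List (Fin (K + 1)) => x.2.length :=
    Primrec.list_length.comp Primrec.snd
  refine primrecPred_forall_mem (Primrec.list_range.comp hlen) ?_
  refine primrecPred_forall_mem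
    (Primrec.list_range.comp (Primrec.succ.comp (hlen.comp Primrec.fst))) ?_
  refine Primrec.nat_le.comp (Primrec.list_length.comp (primrec_filter
    (Primrec.list_range.comp (hlen.comp (Primrec.fst.comp Primrec.fst))) ?_)) ?_
  · have hi : Primrec fun x : (((List (ℕ × ℕ) × List (Fin (K + 1))) × ℕ) × ℕ) × ℕ => x.1.1.2 :=
      Primrec.snd.comp (Primrec.fst.comp Primrec.fst)
    have hm : Primrec fun x : (((List (ℕ × ℕ) × List (Fin (K + 1))) × ℕ) × ℕ) × ℕ => x.1.2 :=
      Primrec.snd.comp Primrec.fst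
    have hw : Primrec fun x : (((List (ℕ × ℕ) × List (Fin (K + 1))) × ℕ) × ℕ) × ℕ => x.1.1.1.2 :=
      Primrec.snd.comp (Primrec.fst.comp (Primrec.fst.comp Primrec.fst))
    exact (Primrec.nat_le.comp hi Primrec.snd).and
      ((Primrec.nat_lt.comp Primrec.snd (Primrec.nat_add.comp hi hm)).and
        (Primrec.eq.comp ((Primrec.list_getD 0).comp hw Primrec.snd) (Primrec.const 0)).not)
  · exact Primrec.fst.comp ((Primrec.list_getD (0, 0)).comp
      (Primrec.fst.comp (Primrec.fst.comp Primrec.fst)) Primrec.snd)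

theorem primrec_wordCount (K : ℕ) : Primrec (wordCount K) :=
  Primrec.list_length.comp (primrec_filter ((primrec_words K).comp
    (Primrec.nat_sub.comp Primrec.list_length (Primrec.const 1))) (primrecRel_goodWord K))

theorem primrec_nextGap (K : ℕ) :
    Primrec fun x : (ℕ × List (ℕ × ℕ)) × List (ℕ × ℕ) => nextGap K x.1.1 x.1.2 x.2 := by
  have hg : Primrec fun l : List (ℕ × ℕ) => (l.getD (l.length - 1) (0, 0)).2 :=
    Primrec.snd.comp ((Primrec.list_getD (0, 0)).comp Primrec.id
      (Primrec.nat_sub.comp Primrec.list_length (Primrec.const 1)))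
  refine Primrec.ite ((Primrec.nat_le.comp (Primrec.succ.comp (hg.comp Primrec.snd))
    (Primrec.fst.comp Primrec.fst)).and (primrecPred_exists_mem (Primrec.snd.comp Primrec.fst) ?_))
    (Primrec.succ.comp (hg.comp Primrec.snd)) (hg.comp Primrec.snd)
  have hl : Primrec fun x : ((ℕ × List (ℕ × ℕ)) × List (ℕ × ℕ)) × ℕ × ℕ => x.1.2 :=
    Primrec.snd.comp Primrec.fst
  exact Primrec.nat_lt.comp (primrec_nat_pow.comp (Primrec.const 2) (Primrec.nat_mul.comp
      (Primrec.fst.comp Primrec.snd)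
      (Primrec.nat_add.comp (Primrec.list_length.comp hl) (hg.comp hl))))
    (primrec_nat_pow.comp ((primrec_wordCount K).comp hl) (Primrec.snd.comp Primrec.snd))

theorem computable_table {σ : Type*} [Primcodable σ] {f : ℕ → ℕ} (hf : Computable f)
    {q : σ → ℕ → ℕ × ℕ} (hq : Computable₂ q) (K : ℕ) :
    Computable₂ fun s n => table f (q s) K n := by
  have hstep : Computable₂ fun (x : σ × ℕ) (y : ℕ × List (ℕ × ℕ)) =>
      y.2 ++ [if y.1 = 0 then (0, 0) else
        (nextValue y.2, nextGap K (f (y.1 - 1)) ((List.range y.1).map (q x.1)) y.2)] := by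
    have hn : Computable fun z : (σ × ℕ) × ℕ × List (ℕ × ℕ) => z.2.1 :=
      Computable.fst.comp Computable.snd
    have hl : Computable fun z : (σ × ℕ) × ℕ × List (ℕ × ℕ) => z.2.2 :=
      Computable.snd.comp Computable.snd
    have hs : Computable fun z : (σ × ℕ) × ℕ × List (ℕ × ℕ) => z.1.1 :=
      Computable.fst.comp Computable.fst
    refine Computable.list_concat.comp hl ?_
    have hb : Computable fun z : (σ × ℕ) × ℕ × List (ℕ × ℕ) => decide (z.2.1 = 0) :=
      ((Primrec.eq.comp Primrec.id (Primrec.const 0)).decide.to_comp).comp hn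
    refine (Computable.cond hb (Computable.const ((0, 0) : ℕ × ℕ))
      (Computable.pair (primrec_nextValue.to_comp.comp hl) ((primrec_nextGap K).to_comp.comp
        (Computable.pair (Computable.pair (hf.comp (Primrec.pred.to_comp.comp hn))
          ((computable_map_range hq).comp hs hn)) hl)))).of_eq fun z => ?_
    simp [Bool.cond_decide]
  refine (Computable.nat_rec Computable.snd (Computable.const []) hstep).of_eq fun x => ?_
  rcases x with ⟨s, n⟩
  induction n with
  | zero => rfl
  | succ n ih => simp only [table] at ih ⊢; rw [ih]

theorem le_foldr_max {l : List ℕ} {b x : ℕ} (h : x ∈ l ∨ x ≤ b) : x ≤ l.foldr max b := by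
  induction l with
  | nil => simpa using h
  | cons a l ih =>
    simp only [List.foldr_cons, List.mem_cons] at *
    rcases h with (rfl | h) | h
    · exact le_max_left _ _
    · exact le_max_of_le_right (ih (Or.inl h))
    · exact le_max_of_le_right (ih (Or.inr h))

theorem foldr_max_eq (l : List ℕ) (b : ℕ) : l.foldr max b = b ∨ l.foldr max b ∈ l := by
  induction l with
  | nil => simp
  | cons a l ih =>
    simp only [List.foldr_cons, List.mem_cons]
    rcases max_choice a (l.foldr max b) with h | h <;> rw [h] <;> tauto

section table

variable (f : ℕ → ℕ) (q : ℕ → ℕ × ℕ) (K : ℕ)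

/-- The pair of the value and the gap at `n`. -/
def entry (n : ℕ) : ℕ × ℕ :=
  if n = 0 then (0, 0) else (nextValue (table f q K n),
    nextGap K (f (n - 1)) ((List.range n).map q) (table f q K n))

theorem table_eq (n : ℕ) : table f q K n = (List.range n).map (entry f q K) := by
  induction n with
  | zero => rfl
  | succ n ih => rw [List.range_succ, List.map_append, ← ih]; rfl

theorem table_length (n : ℕ) : (table f q K n).length = n := by
  rw [table_eq, List.length_map, List.length_range]

theorem table_getD {n i : ℕ} (h : i < n) : (table f q K n).getD i (0, 0) = entry f q K i := by
  rw [table_eq, List.getD_eq_getElem _ _ (by simpa using h)]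
  simp

/-- The density profile. -/
def profile (n : ℕ) : ℕ := (entry f q K n).1

/-- The gap function. -/
def gap (n : ℕ) : ℕ := (entry f q K n).2

theorem profile_succ (n : ℕ) : profile f q K (n + 1) = nextValue (table f q K (n + 1)) := rfl

theorem gap_succ_eq (n : ℕ) : gap f q K (n + 1) =
    nextGap K (f n) ((List.range (n + 1)).map q) (table f q K (n + 1)) := rfl

theorem profile_le_succ (n : ℕ) : profile f q K n ≤ profile f q K (n + 1) := by
  rw [profile_succ, nextValue]
  refine le_foldr_max (Or.inr ?_)
  rw [table_length, Nat.add_sub_cancel, table_getD f q K (Nat.lt_succ_self n)]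
  exact le_max_right _ _

theorem isProfile : IsProfile (profile f q K) (gap f q K) where
  zero := rfl
  -- The floor `max 1` in `nextValue` starts the recursion here; it has no effect later, as all
  -- further values are at least `1`.
  one := rfl
  mono := monotone_nat_of_le_succ (profile_le_succ f q K)
  glue := by
    intro a b hba
    rcases Nat.eq_zero_or_pos b with rfl | hb
    · exact monotone_nat_of_le_succ (profile_le_succ f q K) (by omega : a ≤ _)
    -- For `b > 0` the index `a` is strictly below `a + b + G a`, so the pair is among the
    -- candidates of `nextValue` at that length.
    obtain ⟨m, hm⟩ : ∃ m, a + b + gap f q K a = m + 1 := ⟨a + b + gap f q K a - 1, by omega⟩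
    rw [hm, profile_succ, nextValue]
    refine le_foldr_max (Or.inl ?_)
    rw [table_length]
    simp only [List.mem_flatMap, List.mem_range, List.mem_map]
    refine ⟨a, by omega, b, by omega, ?_⟩
    rw [table_getD f q K (by omega), table_getD f q K (by omega), if_pos]
    · rfl
    · exact hm.le
  succ_le := by
    intro n hn
    have hmono := monotone_nat_of_le_succ (profile_le_succ f q K)
    have h1 : 1 ≤ profile f q K n := hmono hn
    rw [profile_succ, nextValue, table_length]
    rcases foldr_max_eq ((List.range (n + 1)).flatMap fun a => (List.range (a + 1)).map fun b =>
      if a + b + ((table f q K (n + 1)).getD a (0, 0)).2 ≤ n + 1 then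
        ((table f q K (n + 1)).getD a (0, 0)).1 + ((table f q K (n + 1)).getD b (0, 0)).1
      else 0) (max 1 ((table f q K (n + 1)).getD (n + 1 - 1) (0, 0)).1) with h | h
    · rw [h, Nat.add_sub_cancel, table_getD f q K (Nat.lt_succ_self n)]
      exact Or.inl (max_le h1 le_rfl)
    · simp only [List.mem_flatMap, List.mem_range, List.mem_map] at h
      obtain ⟨a, ha, b, hb, e⟩ := h
      rw [table_getD f q K ha, table_getD f q K (by omega : b < n + 1)] at e
      split_ifs at e with hc
      · exact Or.inr ⟨a, b, by omega, by omega, hc, e.symm⟩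
      · rw [← e]; exact Or.inl (Nat.zero_le _)
  gap_zero := rfl
  gap_succ := by
    intro n
    have e : ((table f q K (n + 1)).getD ((table f q K (n + 1)).length - 1) (0, 0)).2
        = gap f q K n := by
      rw [table_length, Nat.add_sub_cancel, table_getD f q K (Nat.lt_succ_self n)]; rfl
    rw [gap_succ_eq, nextGap, e]
    split_ifs <;> simp

end table

theorem mem_words {K n : ℕ} {w : List (Fin (K + 1))} : w ∈ words K n ↔ w.length = n := by
  induction n generalizing w with
  | zero => simp [words]
  | succ n ih =>
    simp only [words, List.mem_flatMap, List.mem_map, List.mem_finRange, true_and]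
    constructor
    · rintro ⟨v, hv, a, rfl⟩
      simpa using ih.1 hv
    · intro h
      rcases w with _ | ⟨a, v⟩
      · simp at h
      · exact ⟨v, ih.2 (by simpa using h), a, rfl⟩

theorem nodup_words (K n : ℕ) : (words K n).Nodup := by
  induction n with
  | zero => simp [words]
  | succ n ih =>
    rw [words, List.nodup_flatMap]
    refine ⟨fun w _ => (List.nodup_finRange _).map fun a b h => by simpa using h, ?_⟩
    refine ih.imp fun {v w} hvw => ?_
    simp only [Function.onFun, List.disjoint_left, List.mem_map]
    rintro _ ⟨a, _, rfl⟩ ⟨b, _, h⟩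
    exact hvw (by simpa using h.symm : a = b ∧ v = w).2

/-- The word `w`, placed at the origin, as a sequence. -/
def wordSeq {K : ℕ} (w : List (Fin (K + 1))) (t : ℤ) : Fin (K + 1) :=
  if 0 ≤ t then w.getD t.toNat 0 else 0

theorem wordSeq_ne_zero {K : ℕ} {w : List (Fin (K + 1))} {t : ℤ} (h : wordSeq w t ≠ 0) :
    0 ≤ t ∧ t < w.length := by
  unfold wordSeq at h
  split_ifs at h with h0
  · refine ⟨h0, ?_⟩
    by_contra hlt
    exact h (List.getD_eq_default _ _ (by omega))
  · simp at h

theorem wordSeq_natCast {K : ℕ} (w : List (Fin (K + 1))) (t : ℕ) : wordSeq w t = w.getD t 0 := by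
  simp [wordSeq]

theorem wordSeq_mem_blocks {K n : ℕ} {p : ℕ → ℕ} (hp : Monotone p) {l : List (ℕ × ℕ)}
    (hl : ∀ m ≤ n, (l.getD m (0, 0)).1 = p m) {w : List (Fin (K + 1))} (hw : w.length = n) :
    wordSeq w ∈ blocks p K n ↔ GoodWord l w := by
  subst hw
  have hcard : ∀ i m, ((List.range w.length).filter
      fun t => i ≤ t ∧ t < i + m ∧ w.getD t 0 ≠ 0).length =
      ((Finset.range w.length).filter fun t => i ≤ t ∧ t < i + m ∧ w.getD t 0 ≠ 0).card := by
    intro i m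
    rw [← List.toFinset_card_of_nodup (List.nodup_range.filter _)]
    congr 1
    ext t
    simp
  constructor
  · rintro ⟨hadm, -⟩ i _ m hm
    rw [hl m (by simpa [Nat.lt_succ_iff] using hm), hcard,
      ← Finset.card_image_of_injective (f := fun i : ℕ => (i : ℤ)) _ Nat.cast_injective]
    refine hadm _ m ?_ ?_
    · intro t ht
      obtain ⟨s, hs, rfl⟩ := Finset.mem_image.1 ht
      simp only [Set.mem_ofPred_eq, wordSeq_natCast]
      exact (Finset.mem_filter.1 hs).2.2.2
    · intro s hs t ht
      obtain ⟨s', hs', rfl⟩ := Finset.mem_image.1 hs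
      obtain ⟨t', ht', rfl⟩ := Finset.mem_image.1 ht
      have := (Finset.mem_filter.1 hs').2
      have := (Finset.mem_filter.1 ht').2
      omega
  · intro hgood
    refine ⟨fun F m hF hm => ?_, fun t ht => wordSeq_ne_zero ht⟩
    rcases F.eq_empty_or_nonempty with rfl | ne
    · simp
    have hmem : ∀ t ∈ F, 0 ≤ t ∧ t < w.length := fun t ht => wordSeq_ne_zero (hF ht)
    have h0 := hmem _ (F.min'_mem ne)
    have hle : ∀ t ∈ F, F.min' ne ≤ t := fun t ht => F.min'_le t ht
    -- It suffices to test the window that starts at the minimum of `F`, cut to the length of the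
    -- word; only such windows occur in `GoodWord`.
    have h1 := hgood (F.min' ne).toNat (List.mem_range.2 (by omega)) (min m w.length)
      (List.mem_range.2 (by omega))
    rw [hl _ (by omega), hcard] at h1
    refine le_trans ?_ (h1.trans (hp (min_le_left _ _)))
    refine Finset.card_le_card_of_injOn Int.toNat (fun t ht => ?_) fun s hs t ht e => ?_
    · have h2 := hmem t ht
      have h3 := hle t ht
      have h4 := hm t ht _ (F.min'_mem ne)
      have h5 := hF ht
      simp only [Finset.coe_filter, Finset.mem_range, Set.mem_ofPred_eq] at h5 ⊢
      refine ⟨by omega, by omega, by omega, ?_⟩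
      rwa [← wordSeq_natCast, Int.toNat_of_nonneg h2.1]
    · have := hmem t ht
      have := hmem s hs
      omega

theorem wordCount_eq {K n : ℕ} {p : ℕ → ℕ} (hp : Monotone p) {l : List (ℕ × ℕ)}
    (hlen : l.length = n + 1) (hl : ∀ m ≤ n, (l.getD m (0, 0)).1 = p m) :
    wordCount K l = (blocks p K n).ncard := by
  classical
  rw [wordCount, hlen, Nat.add_sub_cancel,
    ← List.toFinset_card_of_nodup ((nodup_words K n).filter _), ← Set.ncard_coe_finset]
  refine Set.ncard_congr (fun w _ => wordSeq w) ?_ ?_ ?_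
  · intro w hw
    simp only [List.coe_toFinset, List.mem_filter, decide_eq_true_eq, Set.mem_ofPred_eq] at hw
    exact (wordSeq_mem_blocks hp hl (mem_words.1 hw.1)).2 hw.2
  · intro v w hv hw e
    simp only [List.coe_toFinset, List.mem_filter, decide_eq_true_eq, Set.mem_ofPred_eq] at hv hw
    have h1 := mem_words.1 hv.1
    have h2 := mem_words.1 hw.1
    refine List.ext_getElem (h1.trans h2.symm) fun i hi hi' => ?_
    have := congrFun e (i : ℤ)
    rwa [wordSeq_natCast, wordSeq_natCast, List.getD_eq_getElem _ _ hi,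
      List.getD_eq_getElem _ _ hi'] at this
  · intro x hx
    have e : wordSeq (List.ofFn fun i : Fin n => x (i : ℕ)) = x := by
      funext t
      by_cases ht : 0 ≤ t ∧ t < n
      · obtain ⟨i, rfl⟩ := Int.eq_ofNat_of_zero_le ht.1
        have hi : i < n := by omega
        rw [wordSeq_natCast, List.getD_eq_getElem _ _ (by simpa using hi)]
        simp
      · rw [blocks_eq_zero hx ht]
        by_contra h
        exact ht (by simpa using wordSeq_ne_zero h)
    refine ⟨List.ofFn fun i : Fin n => x (i : ℕ), ?_, e⟩
    have hlen' : (List.ofFn fun i : Fin n => x (i : ℕ)).length = n := List.length_ofFn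
    simp only [List.coe_toFinset, List.mem_filter, decide_eq_true_eq, Set.mem_ofPred_eq]
    exact ⟨mem_words.2 hlen', (wordSeq_mem_blocks hp hl hlen').1 (by rwa [e])⟩

/-- Taking logarithms and dividing by the denominator turns the integer comparison in `nextGap` into
the real inequality of the rule; the table has length `n + 1`, whence the summand `1`. -/
theorem followsRule (f : ℕ → ℕ) (q : ℕ → ℕ × ℕ) (K : ℕ) (hq : ∀ i, (q i).2 ≠ 0) :
    FollowsRule f (fun i => ((q i).1 : ℝ) / (q i).2) K (profile f q K) (gap f q K) := by
  intro n
  have e : ((table f q K (n + 1)).getD ((table f q K (n + 1)).length - 1) (0, 0)).2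
      = gap f q K n := by
    rw [table_length, Nat.add_sub_cancel, table_getD f q K (Nat.lt_succ_self n)]; rfl
  have hcount : wordCount K (table f q K (n + 1)) = (blocks (profile f q K) K n).ncard :=
    wordCount_eq (isProfile f q K).mono (table_length f q K _) fun m hm => by
      rw [table_getD f q K (by omega)]; rfl
  rw [gap_succ_eq, nextGap, e, table_length, hcount]
  have hiff : (∃ x ∈ (List.range (n + 1)).map q, 2 ^ (x.1 * (n + 1 + gap f q K n)) <
      (blocks (profile f q K) K n).ncard ^ x.2) ↔
      ∃ i ≤ n, ((q i).1 : ℝ) / (q i).2 * (n + gap f q K n + 1) < logBlocks (profile f q K) K n := by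
    simp only [List.mem_map, List.mem_range, Nat.lt_succ_iff]
    constructor
    · rintro ⟨_, ⟨i, hi, rfl⟩, h⟩
      refine ⟨i, hi, ?_⟩
      have hpos : (0 : ℝ) < (q i).2 := by exact_mod_cast Nat.pos_of_ne_zero (hq i)
      have h' : (2 : ℝ) ^ ((q i).1 * (n + 1 + gap f q K n)) <
        ((blocks (profile f q K) K n).ncard : ℝ) ^ (q i).2 := by exact_mod_cast h
      have := Real.logb_lt_logb one_lt_two (by positivity) h'
      rw [Real.logb_pow, Real.logb_pow, Real.logb_self_eq_one one_lt_two, mul_one] at this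
      rw [div_mul_eq_mul_div, div_lt_iff₀ hpos, logBlocks]
      push_cast at this
      linarith
    · rintro ⟨i, hi, h⟩
      refine ⟨_, ⟨i, hi, rfl⟩, ?_⟩
      have hpos : (0 : ℝ) < (q i).2 := by exact_mod_cast Nat.pos_of_ne_zero (hq i)
      have hb : (0 : ℝ) < (blocks (profile f q K) K n).ncard := by
        exact_mod_cast blocks_ncard_pos n
      rw [div_mul_eq_mul_div, div_lt_iff₀ hpos, logBlocks] at h
      have h' : (2 : ℝ) ^ ((q i).1 * (n + 1 + gap f q K n)) <
          ((blocks (profile f q K) K n).ncard : ℝ) ^ (q i).2 := by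
        rw [← Real.logb_lt_logb_iff one_lt_two (by positivity) (by positivity), Real.logb_pow,
          Real.logb_pow, Real.logb_self_eq_one one_lt_two, mul_one]
        push_cast
        linarith
      exact_mod_cast h'
  refine Iff.trans ?_ (and_congr_right' hiff)
  split_ifs with h
  · exact ⟨fun _ => h, fun _ => rfl⟩
  · exact ⟨fun e => by omega, fun hc => absurd hc h⟩

/-! ### Deciding the language, uniformly in the parameter. -/

section decision

variable {d K : ℕ}

/-- The entries of `w` with nonzero symbols in the row of `a`, between `a` and `b`. -/
def between (w : List ((Fin (d + 1) → ℤ) × Fin (K + 1))) (a b : (Fin (d + 1) → ℤ) × Fin (K + 1)) :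
    List ((Fin (d + 1) → ℤ) × Fin (K + 1)) :=
  w.filter fun c => c.2 ≠ 0 ∧ Fin.tail c.1 = Fin.tail a.1 ∧ (a.1 0 - c.1 0).toNat = 0 ∧
    (c.1 0 - b.1 0).toNat = 0

/-- The length of the window from `a` to `b`. -/
def span (a b : (Fin (d + 1) → ℤ) × Fin (K + 1)) : ℕ := (b.1 0 - a.1 0).toNat + 1

/-- The maximal length of a window between entries of `w`. -/
def spanBound (w : List ((Fin (d + 1) → ℤ) × Fin (K + 1))) : ℕ :=
  (w.flatMap fun a => w.map fun b => span a b).foldr max 0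

/-- The pattern `w` is consistent and obeys the profile listed in `l`. -/
def Accepts (l : List (ℕ × ℕ)) (w : List ((Fin (d + 1) → ℤ) × Fin (K + 1))) : Prop :=
  (∀ a ∈ w, ∀ b ∈ w, a.1 = b.1 → a.2 = b.2) ∧
    ∀ a ∈ w, ∀ b ∈ w, (between w a b).dedup.length ≤ (l.getD (span a b) (0, 0)).1

theorem primrec_dedup {α : Type*} [Primcodable α] [DecidableEq α] :
    Primrec (List.dedup : List α → List α) := by
  have h : Primrec fun l : List α => l.foldr (fun a r => if a ∈ r then r else a :: r) [] := by
    refine Primrec.list_foldr (h := fun _ (x : α × List α) => if x.1 ∈ x.2 then x.2 else x.1 :: x.2)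
      Primrec.id (Primrec.const []) ?_
    refine Primrec.ite ?_ (Primrec.snd.comp Primrec.snd)
      (Primrec.list_cons.comp (Primrec.fst.comp Primrec.snd) (Primrec.snd.comp Primrec.snd))
    refine (primrecPred_exists_mem (L := fun y : List α × α × List α => y.2.2)
      (R := fun y b => b = y.2.1) (Primrec.snd.comp Primrec.snd)
      (Primrec.eq.comp Primrec.snd (Primrec.fst.comp (Primrec.snd.comp Primrec.fst)))).of_eq ?_
    simp
  refine h.of_eq fun l => ?_
  induction l with
  | nil => rfl
  | cons a l ih =>
    rw [List.foldr_cons, ih]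
    by_cases ha : a ∈ l
    · rw [List.dedup_cons_of_mem ha, if_pos (List.mem_dedup.2 ha)]
    · rw [List.dedup_cons_of_notMem ha, if_neg (by rwa [List.mem_dedup])]

theorem primrec_first : Primrec fun a : (Fin (d + 1) → ℤ) × Fin (K + 1) => a.1 0 :=
  Primrec.fin_app.comp Primrec.fst (Primrec.const 0)

theorem primrec_tail : Primrec fun a : (Fin (d + 1) → ℤ) × Fin (K + 1) => Fin.tail a.1 :=
  Primrec.fin_curry.2 (Primrec.fin_app.comp (Primrec.fst.comp Primrec.fst)
    (Primrec.fin_succ.comp Primrec.snd))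

theorem primrec_span : Primrec₂ fun a b : (Fin (d + 1) → ℤ) × Fin (K + 1) => span a b :=
  Primrec.succ.comp (primrec_int_sub_toNat.comp (primrec_first.comp Primrec.snd)
    (primrec_first.comp Primrec.fst))

theorem primrec_spanBound : Primrec (spanBound : List ((Fin (d + 1) → ℤ) × Fin (K + 1)) → ℕ) := by
  refine Primrec.list_foldr (h := fun _ x => max x.1 x.2) ?_ (Primrec.const 0)
    (Primrec.nat_max.comp (Primrec.fst.comp Primrec.snd) (Primrec.snd.comp Primrec.snd))
  refine Primrec.list_flatMap Primrec.id (Primrec.list_map Primrec.fst ?_)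
  exact primrec_span.comp (Primrec.snd.comp Primrec.fst) Primrec.snd

theorem primrec_between : Primrec fun x : (List ((Fin (d + 1) → ℤ) × Fin (K + 1)) ×
    ((Fin (d + 1) → ℤ) × Fin (K + 1))) × ((Fin (d + 1) → ℤ) × Fin (K + 1)) =>
      between x.1.1 x.1.2 x.2 := by
  refine primrec_filter (Primrec.fst.comp Primrec.fst) ?_
  have ha : Primrec fun y : ((List ((Fin (d + 1) → ℤ) × Fin (K + 1)) ×
    ((Fin (d + 1) → ℤ) × Fin (K + 1))) × ((Fin (d + 1) → ℤ) × Fin (K + 1))) ×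
    ((Fin (d + 1) → ℤ) × Fin (K + 1)) => y.1.1.2 :=
      Primrec.snd.comp (Primrec.fst.comp Primrec.fst)
  have hb : Primrec fun y : ((List ((Fin (d + 1) → ℤ) × Fin (K + 1)) ×
    ((Fin (d + 1) → ℤ) × Fin (K + 1))) × ((Fin (d + 1) → ℤ) × Fin (K + 1))) ×
    ((Fin (d + 1) → ℤ) × Fin (K + 1)) => y.1.2 := Primrec.snd.comp Primrec.fst
  exact (Primrec.eq.comp (Primrec.snd.comp Primrec.snd) (Primrec.const 0)).not.and
    ((Primrec.eq.comp (primrec_tail.comp Primrec.snd) (primrec_tail.comp ha)).and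
      ((Primrec.eq.comp (primrec_int_sub_toNat.comp (primrec_first.comp ha)
        (primrec_first.comp Primrec.snd)) (Primrec.const 0)).and
      (Primrec.eq.comp (primrec_int_sub_toNat.comp (primrec_first.comp Primrec.snd)
        (primrec_first.comp hb)) (Primrec.const 0))))

theorem primrecRel_accepts : PrimrecRel fun (l : List (ℕ × ℕ))
    (w : List ((Fin (d + 1) → ℤ) × Fin (K + 1))) => Accepts l w := by
  refine PrimrecPred.and ?_ ?_
  · refine primrecPred_forall_mem Primrec.snd (primrecPred_forall_mem
      (Primrec.snd.comp Primrec.fst) ?_)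
    have h1 : PrimrecPred fun y : ((List (ℕ × ℕ) × List ((Fin (d + 1) → ℤ) × Fin (K + 1))) ×
        ((Fin (d + 1) → ℤ) × Fin (K + 1))) × ((Fin (d + 1) → ℤ) × Fin (K + 1)) =>
        ¬ y.1.2.1 = y.2.1 ∨ y.1.2.2 = y.2.2 :=
      (Primrec.eq.comp (Primrec.fst.comp (Primrec.snd.comp Primrec.fst))
        (Primrec.fst.comp Primrec.snd)).not.or
      (Primrec.eq.comp (Primrec.snd.comp (Primrec.snd.comp Primrec.fst))
        (Primrec.snd.comp Primrec.snd))
    exact h1.of_eq fun y => imp_iff_not_or.symm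
  · refine primrecPred_forall_mem Primrec.snd (primrecPred_forall_mem
      (Primrec.snd.comp Primrec.fst) ?_)
    refine Primrec.nat_le.comp (Primrec.list_length.comp (primrec_dedup.comp
      (primrec_between.comp (Primrec.pair (Primrec.pair (Primrec.snd.comp (Primrec.fst.comp
        Primrec.fst)) (Primrec.snd.comp Primrec.fst)) Primrec.snd)))) ?_
    exact Primrec.fst.comp ((Primrec.list_getD (0, 0)).comp
      (Primrec.fst.comp (Primrec.fst.comp Primrec.fst))
      (primrec_span.comp (Primrec.snd.comp Primrec.fst) Primrec.snd))

theorem span_le_spanBound {w : List ((Fin (d + 1) → ℤ) × Fin (K + 1))}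
    {a b : (Fin (d + 1) → ℤ) × Fin (K + 1)} (ha : a ∈ w) (hb : b ∈ w) :
    span a b ≤ spanBound w := by
  refine le_foldr_max (Or.inl ?_)
  simp only [List.mem_flatMap, List.mem_map]
  exact ⟨a, ha, b, hb, rfl⟩

/-- Windows whose two ends are positions of entries of `w` suffice, by monotonicity of `p`. Since a
list may repeat an entry, duplicates are removed before counting; by consistency, distinct entries
in a row then have distinct positions. -/
theorem accepts_iff {p : ℕ → ℕ} (hp : Monotone p) {l : List (ℕ × ℕ)}
    {w : List ((Fin (d + 1) → ℤ) × Fin (K + 1))}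
    (hl : ∀ m ≤ spanBound w, (l.getD m (0, 0)).1 = p m) :
    Accepts l w ↔ w ∈ language (densityShift d K p) := by
  rw [mem_language_densityShift]
  refine and_congr_right fun hcons => ?_
  constructor
  · intro h r F m hF hm
    rcases F.eq_empty_or_nonempty with rfl | ne
    · simp
    obtain ⟨x, hx0, hx⟩ := hF (F.min'_mem ne)
    obtain ⟨y, hy0, hy⟩ := hF (F.max'_mem ne)
    have h1 := h _ hx _ hy
    rw [hl _ (span_le_spanBound hx hy)] at h1
    have hspan : span (Fin.cons (F.min' ne) r, x) (Fin.cons (F.max' ne) r, y) ≤ m := by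
      have := hm _ (F.max'_mem ne) _ (F.min'_mem ne)
      have := F.min'_le_max' ne
      simp only [span, Fin.cons_zero]
      omega
    refine le_trans ?_ (h1.trans (hp hspan))
    rw [← List.card_toFinset]
    refine Finset.card_le_card_of_surjOn (fun c => c.1 0) fun t ht => ?_
    obtain ⟨z, hz0, hz⟩ := hF ht
    refine ⟨(Fin.cons t r, z), ?_, by simp⟩
    have h2 := F.min'_le t ht
    have h3 := F.le_max' t ht
    simp only [List.coe_toFinset, Set.mem_ofPred_eq, between, List.mem_filter, decide_eq_true_eq,
      Fin.tail_cons, Fin.cons_zero, true_and]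
    exact ⟨hz, hz0, by omega, by omega⟩
  · intro h a ha b hb
    rw [hl _ (span_le_spanBound ha hb), ← List.card_toFinset]
    have hmem : ∀ c ∈ (between w a b).toFinset, c ∈ w ∧ c.2 ≠ 0 ∧ Fin.tail c.1 = Fin.tail a.1 ∧
        a.1 0 ≤ c.1 0 ∧ c.1 0 ≤ b.1 0 := by
      intro c hc
      simp only [List.mem_toFinset, between, List.mem_filter, decide_eq_true_eq] at hc
      exact ⟨hc.1, hc.2.1, hc.2.2.1, by omega, by omega⟩
    have hinj : Set.InjOn (fun c : (Fin (d + 1) → ℤ) × Fin (K + 1) => c.1 0)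
        ((between w a b).toFinset : Set ((Fin (d + 1) → ℤ) × Fin (K + 1))) := by
      intro c hc c' hc' e
      have h1 := hmem c hc
      have h2 := hmem c' hc'
      have e1 : c.1 = c'.1 := by
        rw [← Fin.cons_self_tail c.1, ← Fin.cons_self_tail c'.1, h1.2.2.1, h2.2.2.1]
        simp only at e
        rw [e]
      exact Prod.ext e1 (hcons c h1.1 c' h2.1 e1)
    rw [← Finset.card_image_of_injOn hinj]
    refine h (Fin.tail a.1) _ _ ?_ ?_
    · intro t ht
      obtain ⟨c, hc, rfl⟩ := Finset.mem_image.1 ht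
      have h1 := hmem c hc
      refine ⟨c.2, h1.2.1, ?_⟩
      rw [← h1.2.2.1, Fin.cons_self_tail]
      exact h1.1
    · intro s hs t ht
      obtain ⟨c, hc, rfl⟩ := Finset.mem_image.1 hs
      obtain ⟨c', hc', rfl⟩ := Finset.mem_image.1 ht
      have h1 := hmem c hc
      have h2 := hmem c' hc'
      simp only [span]
      omega

/-- The languages of the density shifts of a computable family of profiles are uniformly
decidable. -/
theorem computablePred_language {σ : Type*} [Primcodable σ] {f : ℕ → ℕ} (hf : Computable f)
    {q : σ → ℕ → ℕ × ℕ} (hq : Computable₂ q) :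
    ComputablePred fun x : σ × List ((Fin (d + 1) → ℤ) × Fin (K + 1)) =>
      x.2 ∈ language (densityShift d K (profile f (q x.1) K)) := by
  classical
  have h1 : Computable fun x : σ × List ((Fin (d + 1) → ℤ) × Fin (K + 1)) =>
      table f (q x.1) K (spanBound x.2 + 1) :=
    (computable_table hf hq K).comp Computable.fst
      (Computable.succ.comp (primrec_spanBound.to_comp.comp Computable.snd))
  have h2 : ComputablePred fun x : σ × List ((Fin (d + 1) → ℤ) × Fin (K + 1)) =>
      Accepts (table f (q x.1) K (spanBound x.2 + 1)) x.2 :=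
    ⟨inferInstance, (primrecRel_accepts.decide.to_comp).comp h1 Computable.snd⟩
  refine h2.of_eq fun x => accepts_iff (isProfile f (q x.1) K).mono fun m hm => ?_
  rw [table_getD f (q x.1) K (by omega)]
  rfl

end decision

/-! ### Realization of `α`, and reduction from the halting problem. -/

theorem densityShift_profile_spec {f : ℕ → ℕ} (hmono : Monotone f)
    (hstep : ∀ n, f (n + 1) ≤ f n + 1)
    (hsum : Tendsto (fun N : ℕ => ∑ n ∈ Finset.Icc 1 N, (f n : ℝ) / (n : ℝ) ^ 2) atTop atTop)
    {q : ℕ → ℕ × ℕ} (hq : ∀ i, (q i).2 ≠ 0) {α : ℝ} (hα : 0 < α)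
    (ha : IsGLB (Set.range fun i => ((q i).1 : ℝ) / (q i).2) α) {K : ℕ}
    (hK : α ≤ Real.logb 2 (K + 1)) (d : ℕ) :
    IsIrreducible f (densityShift d K (profile f q K)) ∧
      HasEntropy (densityShift d K (profile f q K)) α :=
  ⟨isIrreducible_densityShift (isProfile f q K)
    ((isProfile f q K).gap_succ_le (followsRule f q K hq) hmono),
  hasEntropy_densityShift ((isProfile f q K).tendsto_logBlocks_div (followsRule f q K hq) hα hK ha
    hmono hstep hsum)⟩

theorem exists_code_of_computablePred {β : Type*} [Primcodable β] {P : β → Prop} [DecidablePred P]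
    (h : ComputablePred P) : ∃ c : Nat.Partrec.Code, ∀ b,
      c.eval (Encodable.encode b) = Part.some (if P b then 1 else 0) := by
  have h1 : Computable fun b => cond (decide (P b)) 1 0 :=
    Computable.cond h.decide (Computable.const 1) (Computable.const 0)
  have h2 : Computable fun n : ℕ => (Encodable.decode (α := β) n).map
      fun b => cond (decide (P b)) 1 0 :=
    Computable.option_map Computable.decode (h1.comp Computable.snd).to₂
  have h3 : Computable fun n : ℕ => ((Encodable.decode (α := β) n).map
      fun b => cond (decide (P b)) 1 0).getD 0 :=
    Computable.option_getD h2 (Computable.const 0)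
  obtain ⟨c, hc⟩ := Nat.Partrec.Code.exists_code.1 (Partrec.nat_iff.1 h3.partrec)
  refine ⟨c, fun b => ?_⟩
  rw [hc]
  simp [Bool.cond_decide]

/-- Uniformly decidable languages have programs that can be computed from the parameter. -/
theorem exists_programs {σ : Type*} [Primcodable σ] {d k : ℕ} (X : σ → ZSubshift d k)
    (h : ComputablePred fun x : σ × List ((Fin d → ℤ) × Fin k) => x.2 ∈ language (X x.1)) :
    ∃ c : σ → Nat.Partrec.Code, Computable c ∧ ∀ s, Decides (c s) (X s) := by
  classical
  obtain ⟨c, hc⟩ := exists_code_of_computablePred h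
  -- The s-m-n theorem: one program decides all the languages, and the parameter is hard-wired into
  -- it.
  refine ⟨fun s => c.curry (Encodable.encode s),
    (Nat.Partrec.Code.primrec₂_curry.to_comp).comp (Computable.const c) Computable.encode,
    fun s w => ?_⟩
  have e : (c.curry (Encodable.encode s)).eval (patternCode w) =
      Part.some (if w ∈ language (X s) then 1 else 0) := by
    rw [Nat.Partrec.Code.eval_curry]
    exact hc (s, w)
  rw [e]
  constructor <;> intro hw <;> simp [hw]

theorem exists_decidable_irreducible {f : ℕ → ℕ} (hf : Computable f) (hmono : Monotone f)
    (hstep : ∀ n, f (n + 1) ≤ f n + 1)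
    (hsum : Tendsto (fun N : ℕ => ∑ n ∈ Finset.Icc 1 N, (f n : ℝ) / (n : ℝ) ^ 2) atTop atTop)
    (d : ℕ) {α : ℝ} (hα : 0 < α) (hpi : IsPi1Computable α) :
    ∃ (k : ℕ) (X : ZSubshift (d + 1) k), IsDecidable X ∧ IsIrreducible f X ∧ HasEntropy X α := by
  obtain ⟨φ, ⟨a, b, ha, hb, hφ⟩, hglb⟩ := hpi
  -- All fractions are at least `α > 0`, so their numerators are positive and `Int.toNat` loses
  -- nothing.
  let q : Unit → ℕ → ℕ × ℕ := fun _ n => ((a n).toNat, b n)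
  have hq : Computable₂ q := Computable.pair
    (primrec_int_toNat.to_comp.comp (ha.comp Computable.snd)) (hb.comp Computable.snd)
  have hval : (fun i => (((q () i).1 : ℕ) : ℝ) / (q () i).2) = fun i => (φ i : ℝ) := by
    funext i
    have h1 : (0 : ℝ) < φ i := hα.trans_le (hglb.1 ⟨i, rfl⟩)
    have h2 : (0 : ℝ) < b i := by exact_mod_cast Nat.pos_of_ne_zero (hφ i).1
    have h3 : ((φ i : ℚ) : ℝ) = (a i : ℝ) / b i := by rw [(hφ i).2]; push_cast; rfl
    rw [h3] at h1 ⊢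
    have h4 : (0 : ℝ) < a i := by
      by_contra hle
      exact absurd h1 (not_lt.2 (div_nonpos_of_nonpos_of_nonneg (not_lt.1 hle) h2.le))
    have h5 : 0 ≤ a i := by exact_mod_cast h4.le
    have h6 : (((a i).toNat : ℕ) : ℝ) = (a i : ℝ) := by exact_mod_cast Int.toNat_of_nonneg h5
    simp only [q, h6]
  obtain ⟨K, hK⟩ := exists_nat_ge ((2 : ℝ) ^ α)
  have hK' : α ≤ Real.logb 2 (K + 1) := by
    rw [Real.le_logb_iff_rpow_le one_lt_two (by positivity)]
    linarith
  obtain ⟨h1, h2⟩ := densityShift_profile_spec hmono hstep hsum (q := q ()) (fun i => (hφ i).1) hα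
    (by rw [hval]; exact hglb) hK' d
  refine ⟨K + 1, densityShift d K (profile f (q ()) K), ?_, h1, h2⟩
  obtain ⟨inst, h3⟩ := computablePred_language (d := d) (K := K) hf hq
  exact ⟨fun w => inst ((), w), (h3.comp (Computable.pair (Computable.const ()) Computable.id))⟩

/-- The fractions `1` or, once the program has halted on input `0`, `1 / 2`. -/
def haltingFractions (c : Nat.Partrec.Code) (n : ℕ) : ℕ × ℕ :=
  (1, cond (c.evaln n 0).isSome 2 1)

theorem computable_haltingFractions : Computable₂ haltingFractions := by
  refine Computable.pair (Computable.const 1) (Computable.cond ?_ (Computable.const 2)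
    (Computable.const 1))
  exact (Primrec.option_isSome.comp (Nat.Partrec.Code.primrec_evaln.comp (Primrec.pair
    (Primrec.pair Primrec.snd Primrec.fst) (Primrec.const 0)))).to_comp

open Classical in
theorem isGLB_haltingFractions (c : Nat.Partrec.Code) :
    IsGLB (Set.range fun i => ((haltingFractions c i).1 : ℝ) / (haltingFractions c i).2)
      (if (c.eval 0).Dom then 1 / 2 else 1) := by
  have hval : ∀ i, ((haltingFractions c i).1 : ℝ) / (haltingFractions c i).2 =
      if (c.evaln i 0).isSome then 1 / 2 else 1 := by
    intro i
    cases h : (c.evaln i 0).isSome <;> simp [haltingFractions, h]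
  simp only [hval]
  split_ifs with hdom
  · obtain ⟨x, hx⟩ := Part.dom_iff_mem.1 hdom
    obtain ⟨i, hi⟩ := Nat.Partrec.Code.evaln_complete.1 hx
    refine IsLeast.isGLB ⟨⟨i, ?_⟩, ?_⟩
    · simp [Option.mem_def.1 hi]
    · rintro _ ⟨j, rfl⟩
      simp only
      split_ifs <;> norm_num
  · have : ∀ i, (c.evaln i 0).isSome = false := by
      intro i
      by_contra hi
      obtain ⟨x, hx⟩ := Option.isSome_iff_exists.1 ((Bool.not_eq_false _).mp hi)
      exact hdom (Part.dom_iff_mem.2 ⟨x, Nat.Partrec.Code.evaln_sound hx⟩)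
    simp [this]

/-- The entropy attached to a program is `1 / 2` or `1` according to whether it halts on `0`; both
values are at most `logb 2 2`, so two symbols suffice. A program for the language is computed from
the given one without knowing which case holds. -/
theorem not_computesEntropy {f : ℕ → ℕ} (hf : Computable f) (hmono : Monotone f)
    (hstep : ∀ n, f (n + 1) ≤ f n + 1)
    (hsum : Tendsto (fun N : ℕ => ∑ n ∈ Finset.Icc 1 N, (f n : ℝ) / (n : ℝ) ^ 2) atTop atTop)
    (d : ℕ) : ¬ ∃ alg : Nat.Partrec.Code × ℕ →. ℤ × ℕ,
      Partrec alg ∧ ComputesEntropy f (d + 1) 2 alg := by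
  classical
  rintro ⟨alg, halg, hcomp⟩
  obtain ⟨c, hc, hdec⟩ := exists_programs
    (fun e => densityShift d 1 (profile f (haltingFractions e) 1))
    (computablePred_language (d := d) (K := 1) hf computable_haltingFractions)
  have hspec : ∀ e : Nat.Partrec.Code, ∃ r ∈ alg (c e, 3), r.2 ≠ 0 ∧
      |(if (e.eval 0).Dom then 1 / 2 else 1) - (r.1 : ℝ) / (r.2 : ℝ)| ≤ (2 : ℝ)⁻¹ ^ 3 := by
    intro e
    have hpos : (0 : ℝ) < if (e.eval 0).Dom then 1 / 2 else 1 := by split_ifs <;> norm_num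
    have hle : (if (e.eval 0).Dom then 1 / 2 else 1 : ℝ) ≤ Real.logb 2 ((1 : ℕ) + 1) := by
      have : Real.logb 2 ((1 : ℕ) + 1) = 1 := by
        rw [Nat.cast_one, one_add_one_eq_two, Real.logb_self_eq_one one_lt_two]
      rw [this]
      split_ifs <;> norm_num
    obtain ⟨h1, h2⟩ := densityShift_profile_spec hmono hstep hsum (q := haltingFractions e)
      (fun i => by cases h : (e.evaln i 0).isSome <;> simp [haltingFractions, h]) hpos
      (isGLB_haltingFractions e) hle d
    exact hcomp _ densityShift_nonempty h1 (c e) (hdec e) _ h2 3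
  choose r hr hr0 hrle using hspec
  have hrc : Computable r :=
    Partrec.of_eq_tot (halg.comp (Computable.pair hc (Computable.const 3))) hr
  refine ComputablePred.halting_problem 0 ?_
  -- An approximation within `1 / 8` lies below `3 / 4` for entropy `1 / 2` and above it for entropy
  -- `1`.
  have hP : PrimrecPred fun x : ℤ × ℕ => 4 * x.1.toNat < 3 * x.2 :=
    Primrec.nat_lt.comp (Primrec.nat_mul.comp (Primrec.const 4)
      (primrec_int_toNat.comp Primrec.fst)) (Primrec.nat_mul.comp (Primrec.const 3) Primrec.snd)
  have hQ : ComputablePred fun e => 4 * (r e).1.toNat < 3 * (r e).2 :=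
    ⟨inferInstance, hP.decide.to_comp.comp hrc⟩
  refine hQ.of_eq fun e => ?_
  have hpos : (0 : ℝ) < (r e).2 := by exact_mod_cast Nat.pos_of_ne_zero (hr0 e)
  have hpos' : 0 < (r e).2 := Nat.pos_of_ne_zero (hr0 e)
  have h1 := abs_le.1 (hrle e)
  have h2 : (r e).1 = ((r e).1 : ℝ) / (r e).2 * (r e).2 := by field_simp
  constructor
  · intro hlt
    by_contra hdom
    rw [if_neg hdom] at h1
    have h3 : (4 : ℝ) * (r e).1 < 3 * (r e).2 := by
      exact_mod_cast (by omega : (4 : ℤ) * (r e).1 < 3 * (r e).2)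
    nlinarith
  · intro hdom
    rw [if_pos hdom] at h1
    have h3 : (4 : ℝ) * (r e).1 < 3 * (r e).2 := by
      norm_num at h1
      nlinarith
    have h4 : (4 : ℤ) * (r e).1 < 3 * (r e).2 := by exact_mod_cast h3
    omega

end EntropyIrr

theorem theorem3p6 (f : ℕ → ℕ) (hf : Computable f) (hmono : Monotone f)
    (hstep : ∀ n, (f (n + 1) : ℤ) - (f n : ℤ) ∈ ({0, 1} : Set ℤ))
    (hsum : Filter.Tendsto (fun N : ℕ => ∑ n ∈ Finset.Icc 1 N, (f n : ℝ) / (n : ℝ) ^ 2)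
      Filter.atTop Filter.atTop)
    (d : ℕ) (hd : 1 ≤ d) :
    (∀ α : ℝ, 0 < α → EntropyIrr.IsPi1Computable α →
      ∃ (k : ℕ) (X : EntropyIrr.ZSubshift d k),
        EntropyIrr.IsDecidable X ∧ EntropyIrr.IsIrreducible f X ∧ EntropyIrr.HasEntropy X α) ∧
    (∃ k : ℕ, ¬ ∃ alg : Nat.Partrec.Code × ℕ →. ℤ × ℕ,
      Partrec alg ∧ EntropyIrr.ComputesEntropy f d k alg) := by
  obtain ⟨d, rfl⟩ : ∃ d', d = d' + 1 := ⟨d - 1, by omega⟩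
  have hstep' : ∀ n, f (n + 1) ≤ f n + 1 := by
    intro n
    have := hstep n
    simp only [Set.mem_insert_iff, Set.mem_singleton_iff] at this
    omega
  exact ⟨fun α hα hpi => EntropyIrr.exists_decidable_irreducible hf hmono hstep' hsum d hα hpi,
    2, EntropyIrr.not_computesEntropy hf hmono hstep' hsum d⟩
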